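/- **Setting (leaderless network).** Fix a horizon $T\in\mathbb N$ and, for $t=1,\dots,T$, real matrices $A_t,D_t,E_t,Q_t,P_t,F_t,H_t$ of size $d_x\times d_x$, $B_t$ of size $d_x\times d_u$ and $R_t$ of size $d_u\times d_u$, none depending on the number $n$ of followers; $Q_t,P_t,F_t,H_t,R_t$ are symmetric. Given a reference $x^0\in\mathbb R^{d_x}$, constant in time, the $n$ followers have states $$x^i_{t+1}=A_tx^i_t+B_tu^i_t+D_t\bar x_t+E_tx^0+w^i_t,\qquad \bar x_t=\tfrac1n\sum_{j=1}^n x^j_t,\qquad i=1,\dots,n,\ t=1,\dots,T,$$ and the cost for tracking a vector $\rho\in\mathbb R^{d_x}$ is $$J(\rho)=\mathbb E\sum_{t=1}^T\Big[(\bar x_t-\rho)^{\top}F_t(\bar x_t-\rho)+\tfrac1n\sum_{i=1}^n\big((x^i_t)^{\top}Q_tx^i_t+(x^i_t-\rho)^{\top}P_t(x^i_t-\rho)+(u^i_t)^{\top}R_tu^i_t\big)+\tfrac1{2n^2}\sum_{i,j=1}^n(x^i_t-x^j_t)^{\top}H_t(x^i_t-x^j_t)\Big],$$ where $\rho=x^0$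 unless another $\rho$ is specified; $\rho$ and $x^0$ may be random. Put $$\bar A_t=\begin{pmatrix}I&0\\E_t&A_t+D_t\end{pmatrix},\quad \bar B_t=\begin{pmatrix}0\\B_t\end{pmatrix},\quad \bar Q_t=\begin{pmatrix}P_t+F_t&-P_t-F_t\\-P_t-F_t&Q_t+P_t+F_t\end{pmatrix},$$ and assume that $Q_t+P_t+H_t$ and $\bar Q_t$ are positive semi-definite and $R_t$ is positive definite. For data $(A,B,Q,R)$ consider the Riccati recursion $M_{T+1}=0$, $$M_t=A_t^{\top}M_{t+1}A_t-A_t^{\top}M_{t+1}B_t(B_t^{\top}M_{t+1}B_t+R_t)^{-1}B_t^{\top}M_{t+1}A_t+Q_t,$$ with gain $L_t=-(B_t^{\top}M_{t+1}B_t+R_t)^{-1}B_t^{\top}M_{t+1}A_t$. Let $\breve L_t$ be the gain for $(A,B,Q+P+H,R)$, and $\bar L_t=(\bar L_t^{2,1}\ \ \bar L_t^{2,2})$, with blocks of size $d_u\times d_x$, the gain for $(\bar A,\bar B,\bar Q,R)$. The initial states $x^1_1,x^2_1,\dots$ and the noises $w^i_t$ ($i\ge1$, $1\le t\le T$) are mutually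 independent on one probability space, the $n$-th network consisting of followers $1,\dots,n$. The initial states are identically distributed with mean $\mu_x$ and finite covariance; the noises have zero mean and finite covariance and, for each $t$, are identically distributed over $i$. The follower strategy with reference $x^0$ is $$u^i_t=\breve L_tx^i_t+\bar L^{2,1}_tx^0+(\bar L^{2,2}_t-\breve L_t)z_t,\qquad z_1=\mu_x,\quad z_{t+1}=(A_t+B_t\bar L^{2,2}_t+D_t)z_t+(B_t\bar L^{2,1}_t+E_t)x^0 .$$ Let $J^*_n(x^0)\in[0,\infty]$ be the infimum of the cost with $\rho=x^0$ over all measurable strategies in which $u^i_t$ is a function of the states of all followers at time $t$ and of $x^0$ (this includes all strategies $u^i_t=g^i_t(x^i_t,x^0)$). Let $s^i_t$ denote the states under the mean-field strategy with reference $\bar x_1$, that is, $v^i_t=\breve L_ts^i_t+\bar L_t^{2,1}\bar x_1+(\bar L_t^{2,2}-\breve L_t)\bar s_t$, $s^i_1=x^i_1$, where $\bar s_t=\frac1n\sum_i s^i_t$. **Corollary (leaderless case).** "Steering the followers to the initial mean" is meant in the sense of asymptotic optimality for the problem of tracking the initial mean. 1. *Reference $x^0\equiv\bar x_1=\frac1n\sum_i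 x^i_1$.* The follower strategy is $\varepsilon(n)$-optimal for tracking $\bar x_1$ with $\varepsilon(n)\in\mathcal O(1/n)$: there is a constant $C$ such that for every $n\ge1$ the cost $J$ of the follower strategy satisfies $J^*_n(\bar x_1)\le J\le J^*_n(\bar x_1)+C/n<\infty$, and $J^*_n(\bar x_1)$ is attained by the mean-field strategy. Moreover, almost surely, $\max_{1\le i\le n}\|x^i_t-s^i_t\|\to0$ as $n\to\infty$ for every $t=1,\dots,T+1$; that is, all followers are steered along the trajectories that are optimal for tracking the initial mean. 2. *Reference $x^0\equiv\mu_x$.* Almost surely $\bar x_1\to\mu_x$ as $n\to\infty$. There is a constant $C$ such that for every $n\ge1$ the resulting follower strategy has cost for tracking $\mu_x$ between $J^*_n(\mu_x)$ and $J^*_n(\mu_x)+C/n<\infty$, and its cost for tracking the initial mean (the cost above with $\rho=\bar x_1$, the network being run with $x^0=\mu_x$) differs from $J^*_n(\bar x_1)$ by at most $C/n$. Moreover, almost surely, $\max_{1\le i\le n}\|x^i_t-s^i_t\|\to0$ as $n\to\infty$ for every $t=1,\dots,T+1$, with the same $s^i_t$ (optimal for tracking $\bar x_1$) as in part 1. 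-/

import Mathlib

open MeasureTheory ProbabilityTheory Filter Topology Matrix

/-! Linear-quadratic leaderless multi-agent network tracking a constant reference, on the horizon
`t = 1, …, T`. All time-dependent data are functions of `t : ℕ`; only `1 ≤ t ≤ T` matters. -/

/-- Column vectors. -/
abbrev Vec (d : ℕ) : Type := Fin d → ℝ

/-- The quadratic form `xᵀ M x`. -/
def quad {d : ℕ} (M : Matrix (Fin d) (Fin d) ℝ) (x : Vec d) : ℝ := x ⬝ᵥ (M *ᵥ x)

/-- The mean-field `(1/n) ∑ i, x i`. -/
noncomputable def meanField {d n : ℕ} (x : Fin n → Vec d) : Vec d := (n : ℝ)⁻¹ • ∑ i, x i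

/-! ### Riccati recursions -/

section Riccati

variable {m k : Type} [Fintype m] [Fintype k] [DecidableEq k]

/-- One backward step of the Riccati recursion; `M` is the matrix at the next time. -/
noncomputable def riccatiStep (A : Matrix m m ℝ) (B : Matrix m k ℝ) (Q : Matrix m m ℝ)
    (R : Matrix k k ℝ) (M : Matrix m m ℝ) : Matrix m m ℝ :=
  -(Aᵀ * M * B * (Bᵀ * M * B + R)⁻¹ * Bᵀ * M * A) + Aᵀ * M * A + Q

/-- The Riccati recursion run backward from the zero terminal value:
`riccatiBack T A B Q R j` is the matrix at time `T + 1 - j`. -/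
noncomputable def riccatiBack (T : ℕ) (A : ℕ → Matrix m m ℝ) (B : ℕ → Matrix m k ℝ)
    (Q : ℕ → Matrix m m ℝ) (R : ℕ → Matrix k k ℝ) : ℕ → Matrix m m ℝ
  | 0 => 0
  | j + 1 => riccatiStep (A (T - j)) (B (T - j)) (Q (T - j)) (R (T - j)) (riccatiBack T A B Q R j)

/-- The solution `M_t` of the Riccati equation with `M_{T+1} = 0`. -/
noncomputable def riccati (T : ℕ) (A : ℕ → Matrix m m ℝ) (B : ℕ → Matrix m k ℝ)
    (Q : ℕ → Matrix m m ℝ) (R : ℕ → Matrix k k ℝ) (t : ℕ) : Matrix m m ℝ :=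
  riccatiBack T A B Q R (T + 1 - t)

theorem riccati_terminal (T : ℕ) (A : ℕ → Matrix m m ℝ) (B : ℕ → Matrix m k ℝ)
    (Q : ℕ → Matrix m m ℝ) (R : ℕ → Matrix k k ℝ) : riccati T A B Q R (T + 1) = 0 := by
  simp [riccati, riccatiBack]

theorem riccati_eq (T : ℕ) (A : ℕ → Matrix m m ℝ) (B : ℕ → Matrix m k ℝ)
    (Q : ℕ → Matrix m m ℝ) (R : ℕ → Matrix k k ℝ) {t : ℕ} (ht : t ≤ T) :
    riccati T A B Q R t =
      riccatiStep (A t) (B t) (Q t) (R t) (riccati T A B Q R (t + 1)) := by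
  have h1 : T + 1 - t = (T - t) + 1 := by omega
  have h2 : T - (T - t) = t := by omega
  have h3 : T + 1 - (t + 1) = T - t := by omega
  simp only [riccati, h1, h3, riccatiBack, h2]

/-- The feedback gain `-(Bᵀ M_{t+1} B + R)⁻¹ Bᵀ M_{t+1} A`. -/
noncomputable def riccatiGain (T : ℕ) (A : ℕ → Matrix m m ℝ) (B : ℕ → Matrix m k ℝ)
    (Q : ℕ → Matrix m m ℝ) (R : ℕ → Matrix k k ℝ) (t : ℕ) : Matrix k m ℝ :=
  -(((B t)ᵀ * riccati T A B Q R (t + 1) * B t + R t)⁻¹ * (B t)ᵀ *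
    riccati T A B Q R (t + 1) * A t)

end Riccati

/-! ### The network -/

/-- Horizon, dynamics matrices and cost matrices of the leaderless network. -/
structure Network (dx du : ℕ) where
  /-- the horizon -/
  T : ℕ
  A : ℕ → Matrix (Fin dx) (Fin dx) ℝ
  B : ℕ → Matrix (Fin dx) (Fin du) ℝ
  D : ℕ → Matrix (Fin dx) (Fin dx) ℝ
  E : ℕ → Matrix (Fin dx) (Fin dx) ℝ
  Q : ℕ → Matrix (Fin dx) (Fin dx) ℝ
  P : ℕ → Matrix (Fin dx) (Fin dx) ℝ
  F : ℕ → Matrix (Fin dx) (Fin dx) ℝ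
  H : ℕ → Matrix (Fin dx) (Fin dx) ℝ
  R : ℕ → Matrix (Fin du) (Fin du) ℝ

/-- A control law for each follower at each time: a function of the states of all `n` followers
and of the reference. This centralized information contains the decentralized one (own state and
reference) and mean-field sharing. -/
abbrev Policy (dx du n : ℕ) : Type := ℕ → Fin n → (Fin n → Vec dx) → Vec dx → Vec du

/-- The policy in which every follower applies `g t` to its own state and the reference. -/
def decentralized {dx du : ℕ} (n : ℕ) (g : ℕ → Vec dx → Vec dx → Vec du) : Policy dx du n :=
  fun t i x r => g t (x i) r

namespace Network

variable {dx du n : ℕ} (S : Network dx du)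

/-- Joint dynamics matrix of (reference, mean-field); the reference is constant. -/
def Abar (t : ℕ) : Matrix (Fin dx ⊕ Fin dx) (Fin dx ⊕ Fin dx) ℝ :=
  Matrix.fromBlocks 1 0 (S.E t) (S.A t + S.D t)

/-- Joint input matrix; the reference has no input. -/
def Bbar (t : ℕ) : Matrix (Fin dx ⊕ Fin dx) (Fin du) ℝ := Matrix.fromRows 0 (S.B t)

/-- Joint weight of (reference, mean-field). -/
def Qbar (t : ℕ) : Matrix (Fin dx ⊕ Fin dx) (Fin dx ⊕ Fin dx) ℝ :=
  Matrix.fromBlocks (S.P t + S.F t) (-S.P t - S.F t) (-S.P t - S.F t) (S.Q t + S.P t + S.F t)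

/-- The standing assumptions on the cost. -/
structure Admissible : Prop where
  symm : ∀ t ∈ Finset.Icc 1 S.T, (S.Q t).IsSymm ∧ (S.P t).IsSymm ∧ (S.F t).IsSymm ∧
    (S.H t).IsSymm ∧ (S.R t).IsSymm
  deviation_posSemidef : ∀ t ∈ Finset.Icc 1 S.T, (S.Q t + S.P t + S.H t).PosSemidef
  joint_posSemidef : ∀ t ∈ Finset.Icc 1 S.T, (S.Qbar t).PosSemidef
  input_posDef : ∀ t ∈ Finset.Icc 1 S.T, (S.R t).PosDef

/-- The gain on deviations from the mean-field. -/
noncomputable def Lbreve (t : ℕ) : Matrix (Fin du) (Fin dx) ℝ :=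
  riccatiGain S.T S.A S.B (fun t => S.Q t + S.P t + S.H t) S.R t

/-- The joint gain on (reference, mean-field). -/
noncomputable def Lbar (t : ℕ) : Matrix (Fin du) (Fin dx ⊕ Fin dx) ℝ :=
  riccatiGain S.T S.Abar S.Bbar S.Qbar S.R t

/-- The block of the joint gain that multiplies the reference. -/
noncomputable def Lref (t : ℕ) : Matrix (Fin du) (Fin dx) ℝ := (S.Lbar t).toCols₁

/-- The block of the joint gain that multiplies the mean-field. -/
noncomputable def Lmean (t : ℕ) : Matrix (Fin du) (Fin dx) ℝ := (S.Lbar t).toCols₂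

/-- States of the `n` followers at times `t = 1, 2, …` under the policy `c`, for reference `r`,
initial states `x₁` and noises `w t i` (the value at `t = 0` is a dummy). -/
noncomputable def state (c : Policy dx du n) (r : Vec dx) (x₁ : Fin n → Vec dx)
    (w : ℕ → Fin n → Vec dx) : ℕ → Fin n → Vec dx
  | 0 => x₁
  | 1 => x₁
  | t + 2 => fun i =>
      S.A (t + 1) *ᵥ state c r x₁ w (t + 1) i
      + S.B (t + 1) *ᵥ c (t + 1) i (state c r x₁ w (t + 1)) r
      + S.D (t + 1) *ᵥ meanField (state c r x₁ w (t + 1))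
      + S.E (t + 1) *ᵥ r + w (t + 1) i

/-- Actions of the followers along the states above. -/
noncomputable def action (c : Policy dx du n) (r : Vec dx) (x₁ : Fin n → Vec dx)
    (w : ℕ → Fin n → Vec dx) (t : ℕ) (i : Fin n) : Vec du :=
  c t i (S.state c r x₁ w t) r

/-- The cost, over `t = 1, …, T`, of states `x` and actions `u` for tracking `ρ`. -/
noncomputable def cost (ρ : Vec dx) (x : ℕ → Fin n → Vec dx) (u : ℕ → Fin n → Vec du) : ℝ :=
  ∑ t ∈ Finset.Icc 1 S.T,
    (quad (S.F t) (meanField (x t) - ρ)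
      + 1 / (n : ℝ) * ∑ i, (quad (S.Q t) (x t i) + quad (S.P t) (x t i - ρ) + quad (S.R t) (u t i))
      + 1 / (2 * (n : ℝ) ^ 2) * ∑ i, ∑ j, quad (S.H t) (x t i - x t j))

/-- The approximation `z_t` of the mean-field, with `z_1 = μ`, for reference `r`
(the value at `t = 0` is a dummy). -/
noncomputable def approxMean (μ r : Vec dx) : ℕ → Vec dx
  | 0 => μ
  | 1 => μ
  | t + 2 =>
      (S.A (t + 1) + S.B (t + 1) * S.Lmean (t + 1) + S.D (t + 1)) *ᵥ approxMean μ r (t + 1)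
      + (S.B (t + 1) * S.Lref (t + 1) + S.E (t + 1)) *ᵥ r

/-- The proposed follower strategy, as a function of time, own state and reference. -/
noncomputable def followerLaw (μ : Vec dx) (t : ℕ) (x r : Vec dx) : Vec du :=
  S.Lbreve t *ᵥ x + S.Lref t *ᵥ r + (S.Lmean t - S.Lbreve t) *ᵥ S.approxMean μ r t

/-- The proposed strategy of all `n` followers. -/
noncomputable def proposed (μ : Vec dx) (n : ℕ) : Policy dx du n :=
  decentralized n (S.followerLaw μ)

/-- The linear strategy that uses the true mean-field. -/
noncomputable def meanFieldPolicy (n : ℕ) : Policy dx du n := fun t i x r =>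
  S.Lbreve t *ᵥ x i + S.Lref t *ᵥ r + (S.Lmean t - S.Lbreve t) *ᵥ meanField x

/-! ### The stochastic network: initial states `x₁ i` and noises `w t i` of followers
`i = 0, 1, 2, …`; the `n`-th network consists of the first `n` of them. -/

variable {Ω : Type*} (x₁ : ℕ → Ω → Vec dx) (w : ℕ → ℕ → Ω → Vec dx)

/-- The random states of the `n`-th network under `c` when the reference signal is `r`. -/
noncomputable def randomState (c : Policy dx du n) (r : Ω → Vec dx) (ω : Ω) :
    ℕ → Fin n → Vec dx :=
  S.state c (r ω) (fun i => x₁ i ω) (fun t i => w t i ω)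

/-- The random actions of the `n`-th network under `c` when the reference signal is `r`. -/
noncomputable def randomAction (c : Policy dx du n) (r : Ω → Vec dx) (ω : Ω) :
    ℕ → Fin n → Vec du :=
  S.action c (r ω) (fun i => x₁ i ω) (fun t i => w t i ω)

/-- The expected cost for tracking `ρ` when the network runs under `c` with reference signal `r`.
The cost is nonnegative for admissible networks, so its expectation always exists in `[0, ∞]`. -/
noncomputable def expectedCost [MeasurableSpace Ω] (μΩ : Measure Ω) (ρ r : Ω → Vec dx)
    (c : Policy dx du n) : ENNReal :=
  ∫⁻ ω, ENNReal.ofReal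
    (S.cost (ρ ω) (S.randomState x₁ w c r ω) (S.randomAction x₁ w c r ω)) ∂μΩ

/-- The optimal expected cost of `n` followers tracking the reference signal `r`: the infimum over
all measurable policies, each follower seeing the reference and the states of all followers. -/
noncomputable def optimalCost [MeasurableSpace Ω] (μΩ : Measure Ω) (n : ℕ) (r : Ω → Vec dx) :
    ENNReal :=
  ⨅ (c : Policy dx du n)
    (_ : ∀ t i, Measurable fun p : (Fin n → Vec dx) × Vec dx => c t i p.1 p.2),
    S.expectedCost x₁ w μΩ r r c

end Network

/-- The initial mean of the first `n` followers. -/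
noncomputable def initialMean {dx : ℕ} {Ω : Type*} (x₁ : ℕ → Ω → Vec dx) (n : ℕ) (ω : Ω) :
    Vec dx :=
  meanField fun i : Fin n => x₁ i ω

/-- Assumptions on the primitive random variables: all are mutually independent; the initial
states are identically distributed with mean `μx` and finite covariance; the local noises are
centered with finite covariance and, at each time, identically distributed over the followers. -/
structure PrimitiveVariables {dx : ℕ} {Ω : Type*} [MeasurableSpace Ω] (μΩ : Measure Ω) (μx : Vec dx)
    (x₁ : ℕ → Ω → Vec dx) (w : ℕ → ℕ → Ω → Vec dx) : Prop where
  measurable_init : ∀ i, Measurable (x₁ i)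
  measurable_noise : ∀ t i, Measurable (w t i)
  indep : iIndepFun (Sum.elim x₁ fun p : ℕ × ℕ => w p.1 p.2) μΩ
  identDistrib_init : ∀ i, IdentDistrib (x₁ i) (x₁ 0) μΩ μΩ
  memLp_init : MemLp (x₁ 0) 2 μΩ
  mean_init : ∫ ω, x₁ 0 ω ∂μΩ = μx
  identDistrib_noise : ∀ t i, IdentDistrib (w t i) (w t 0) μΩ μΩ
  memLp_noise : ∀ t, MemLp (w t 0) 2 μΩ
  mean_noise : ∀ t, ∫ ω, w t 0 ω ∂μΩ = 0

/-!
Write `x̃ⁱ = xⁱ - x̄` and `ũⁱ = uⁱ - ū` for the deviations from the averages. The cost is the average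
of a linear-quadratic cost of the deviations, with weights `(Q + P + H, R)`, plus a linear-quadratic
cost of the pair (target, mean-field), with weights `(Q̄, R)` (`Network.cost_eq`), and both parts
have decoupled linear dynamics. In each part the square is completed along the Riccati recursion
(`qform_riccatiStep`, `lq_identity`). The cross terms between the noise and the predicted next state
have mean zero, because the noise at time `t` is independent of the past and centered
(`integral_lq`). Hence, for a reference `r` determined by the initial states, every policy with
square-integrable inputs has expected cost `value r + gap`, where `value r` depends only on the
primitive random variables and `gap ≥ 0` is a weighted mean square of the distance of the inputs
from the optimal feedback (`Network.integral_cost`). A policy of finite cost has square-integrable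
inputs, since `R` is positive definite, so `value r` is the optimal cost; the mean-field strategy
has no gap and attains it (`Network.optimalCost_eq`).

The proposed strategy is the optimal feedback with `x̄` replaced by `z`, so its gap is a mean
quadratic form of `x̄ - z` (`Network.gap_feedback`). Whatever the reference, this error starts at
`x̄₁ - μx`, evolves linearly and is driven by the average noise; it therefore has second moment
`O(1/n)` (`Network.sqMeanRate_approxMean`), and so does the gap.

When the network runs with reference `μx` but the target is `x̄₁`, put `δ = x̄₁ - μx`. Replacing the
target, and replacing the reference in the optimal value, produce terms quadratic in `δ` and terms
linear in `δ` whose other factor is deterministic up to an error with second moment `O(1/n)`. As `δ`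
is centered with second moment `O(1/n)`, all of them have mean `O(1/n)`
(`Network.invRate_cost_target_sub`, `Network.invRate_value_sub`).

Finally, the deviations `x̃ⁱ` are the same under the proposed and the mean-field strategy
(`Network.deviation_feedback_eq`), so all followers differ by the one vector `x̄ - s̄`. By the strong
law of large numbers `x̄₁ → μx` and the averages of the noises tend to zero almost surely; the linear
recursions for `x̄ - z` and `s̄ - z` then give `x̄ - s̄ → 0`
(`Network.tendsto_proposed_sub_meanFieldPolicy`).
-/

/-! ### Quadratic forms and completion of squares -/

section QuadraticForm

theorem Matrix.PosSemidef.isSymm {m : Type} {M : Matrix m m ℝ} (hM : M.PosSemidef) : M.IsSymm := by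
  simpa [IsHermitian, IsSymm, conjTranspose_eq_transpose_of_trivial] using hM.isHermitian

variable {m k : Type} [Fintype m] [Fintype k]

/-- The quadratic form `xᵀ M x` over an arbitrary finite index type; on `Vec d` it is `quad`. -/
def qform (M : Matrix m m ℝ) (x : m → ℝ) : ℝ := x ⬝ᵥ (M *ᵥ x)

theorem quad_eq_qform {d : ℕ} (M : Matrix (Fin d) (Fin d) ℝ) (x : Vec d) :
    quad M x = qform M x := rfl

theorem dotProduct_mulVec_symm {M : Matrix m m ℝ} (hM : M.IsSymm) (x y : m → ℝ) :
    x ⬝ᵥ (M *ᵥ y) = y ⬝ᵥ (M *ᵥ x) := by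
  rw [dotProduct_mulVec, ← mulVec_transpose, hM.eq, dotProduct_comm]

theorem mulVec_dotProduct (N : Matrix m k ℝ) (x : k → ℝ) (y : m → ℝ) :
    (N *ᵥ x) ⬝ᵥ y = x ⬝ᵥ (Nᵀ *ᵥ y) := by
  rw [dotProduct_comm, dotProduct_mulVec, ← mulVec_transpose, dotProduct_comm]

theorem qform_add {M : Matrix m m ℝ} (hM : M.IsSymm) (x y : m → ℝ) :
    qform M (x + y) = qform M x + qform M y + 2 * (x ⬝ᵥ (M *ᵥ y)) := by
  simp only [qform, mulVec_add, dotProduct_add, add_dotProduct]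
  rw [dotProduct_mulVec_symm hM y x]; ring

theorem qform_sub {M : Matrix m m ℝ} (hM : M.IsSymm) (x y : m → ℝ) :
    qform M (x - y) = qform M x + qform M y - 2 * (x ⬝ᵥ (M *ᵥ y)) := by
  simp only [qform, mulVec_sub, dotProduct_sub, sub_dotProduct]
  rw [dotProduct_mulVec_symm hM y x]; ring

theorem qform_sub_comm (M : Matrix m m ℝ) (x y : m → ℝ) :
    qform M (x - y) = qform M (y - x) := by
  rw [← neg_sub y x]
  simp only [qform, mulVec_neg, dotProduct_neg, neg_dotProduct, neg_neg]

theorem qform_matrix_add (M N : Matrix m m ℝ) (x : m → ℝ) :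
    qform (M + N) x = qform M x + qform N x := by
  simp [qform, add_mulVec]

theorem qform_mulVec (M : Matrix m m ℝ) (N : Matrix m k ℝ) (x : k → ℝ) :
    qform M (N *ᵥ x) = qform (Nᵀ * M * N) x := by
  simp only [qform, mulVec_dotProduct, mulVec_mulVec, Matrix.mul_assoc]

@[simp] theorem qform_zero (M : Matrix m m ℝ) : qform M 0 = 0 := by simp [qform]

theorem Matrix.PosSemidef.qform_nonneg {M : Matrix m m ℝ} (hM : M.PosSemidef) (x : m → ℝ) :
    0 ≤ qform M x := by
  simpa [qform] using hM.dotProduct_mulVec_nonneg x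

theorem posSemidef_of_qform_nonneg {M : Matrix m m ℝ} (hM : M.IsSymm)
    (h : ∀ x, 0 ≤ qform M x) : M.PosSemidef :=
  .of_dotProduct_mulVec_nonneg
    (by simpa [IsHermitian, IsSymm, conjTranspose_eq_transpose_of_trivial] using hM)
    (fun x => by simpa [qform] using h x)

/-- The curvature `Bᵀ M B + R` in the input is invertible. -/
theorem posDef_conj_add {M : Matrix m m ℝ} (hM : M.PosSemidef) (B : Matrix m k ℝ)
    {R : Matrix k k ℝ} (hR : R.PosDef) : (Bᵀ * M * B + R).PosDef := by
  have h := hM.conjTranspose_mul_mul_same B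
  rw [conjTranspose_eq_transpose_of_trivial] at h
  exact PosDef.posSemidef_add h hR

variable [DecidableEq k]

/-- Completion of the square in one step of the Riccati recursion. -/
theorem qform_riccatiStep (A : Matrix m m ℝ) (B : Matrix m k ℝ) (Q : Matrix m m ℝ)
    {R : Matrix k k ℝ} {M : Matrix m m ℝ} (hM : M.PosSemidef) (hR : R.PosDef)
    (y : m → ℝ) (v : k → ℝ) :
    qform M (A *ᵥ y + B *ᵥ v) + qform Q y + qform R v
      = qform (riccatiStep A B Q R M) y
        + qform (Bᵀ * M * B + R)
          (v - -((Bᵀ * M * B + R)⁻¹ * Bᵀ * M * A) *ᵥ y) := by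
  have hG := posDef_conj_add hM B hR
  have hMs := hM.isSymm
  have hGs := hG.posSemidef.isSymm
  have hdet : IsUnit (Bᵀ * M * B + R).det := (isUnit_iff_isUnit_det _).1 hG.isUnit
  set G := Bᵀ * M * B + R with hGdef
  -- `p` is the linear coefficient of the input
  set p : k → ℝ := (Bᵀ * M * A) *ᵥ y with hp
  have h1 : -(G⁻¹ * Bᵀ * M * A) *ᵥ y = -(G⁻¹ *ᵥ p) := by
    simp [hp, neg_mulVec, mulVec_mulVec, Matrix.mul_assoc]
  have h2 : G *ᵥ (G⁻¹ *ᵥ p) = p := by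
    rw [mulVec_mulVec, mul_nonsing_inv _ hdet, one_mulVec]
  have h3 : qform (Aᵀ * M * B * G⁻¹ * Bᵀ * M * A) y = p ⬝ᵥ (G⁻¹ *ᵥ p) := by
    have : (Bᵀ * M * A)ᵀ = Aᵀ * M * B := by
      simp [Matrix.transpose_mul, hMs.eq, Matrix.mul_assoc]
    rw [hp, mulVec_dotProduct, this]
    simp [qform, mulVec_mulVec, Matrix.mul_assoc]
  have h4 : (A *ᵥ y) ⬝ᵥ (M *ᵥ (B *ᵥ v)) = v ⬝ᵥ p := by
    rw [dotProduct_mulVec_symm hMs, mulVec_dotProduct]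
    simp [hp, mulVec_mulVec, Matrix.mul_assoc]
  have h5 : qform G v = qform M (B *ᵥ v) + qform R v := by
    rw [hGdef, qform_matrix_add, qform_mulVec]
  have h6 : qform G (G⁻¹ *ᵥ p) = p ⬝ᵥ (G⁻¹ *ᵥ p) := by
    rw [qform, h2, dotProduct_comm]
  have h7 : qform (riccatiStep A B Q R M) y
      = qform M (A *ᵥ y) + qform Q y - qform (Aᵀ * M * B * G⁻¹ * Bᵀ * M * A) y := by
    rw [riccatiStep, ← hGdef, qform_matrix_add, qform_matrix_add, qform_mulVec]
    simp only [qform, neg_mulVec, dotProduct_neg]; ring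
  rw [h1, sub_neg_eq_add, qform_add hMs, qform_add hGs, h2, h4, h5, h6, h7, h3]
  ring

theorem riccatiStep_posSemidef (A : Matrix m m ℝ) (B : Matrix m k ℝ) {Q : Matrix m m ℝ}
    {R : Matrix k k ℝ} {M : Matrix m m ℝ} (hM : M.PosSemidef) (hQ : Q.PosSemidef)
    (hR : R.PosDef) : (riccatiStep A B Q R M).PosSemidef := by
  have hGs := (posDef_conj_add hM B hR).posSemidef.isSymm
  have hMs := hM.isSymm
  refine posSemidef_of_qform_nonneg ?_ fun x => ?_
  · have hi : ((Bᵀ * M * B + R)⁻¹)ᵀ = (Bᵀ * M * B + R)⁻¹ := by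
      rw [transpose_nonsing_inv, hGs.eq]
    rw [IsSymm, riccatiStep]
    generalize (Bᵀ * M * B + R)⁻¹ = N at hi
    simp only [transpose_add, transpose_neg, transpose_mul, transpose_transpose, hMs.eq,
      hQ.isSymm.eq, hi, Matrix.mul_assoc]
  · -- along the optimal input the square vanishes
    have h := qform_riccatiStep A B Q hM hR x (-((Bᵀ * M * B + R)⁻¹ * Bᵀ * M * A) *ᵥ x)
    rw [sub_self, qform_zero, add_zero] at h
    rw [← h]
    exact add_nonneg (add_nonneg (hM.qform_nonneg _) (hQ.qform_nonneg _))
      (hR.posSemidef.qform_nonneg _)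

variable {T : ℕ} {A : ℕ → Matrix m m ℝ} {B : ℕ → Matrix m k ℝ} {Q : ℕ → Matrix m m ℝ}
  {R : ℕ → Matrix k k ℝ}

theorem riccati_posSemidef (hQ : ∀ t ∈ Finset.Icc 1 T, (Q t).PosSemidef)
    (hR : ∀ t ∈ Finset.Icc 1 T, (R t).PosDef) {t : ℕ} (ht : 1 ≤ t) :
    (riccati T A B Q R t).PosSemidef := by
  have key : ∀ j, j ≤ T → (riccatiBack T A B Q R j).PosSemidef := by
    intro j
    induction j with
    | zero => intro _; exact PosSemidef.zero
    | succ j ih =>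
      intro hj
      have hmem : T - j ∈ Finset.Icc 1 T := by simp only [Finset.mem_Icc]; omega
      exact riccatiStep_posSemidef _ _ (ih (by omega)) (hQ _ hmem) (hR _ hmem)
  exact key _ (by omega)

/-- The weight of the deviation of the input from the optimal feedback. -/
noncomputable def riccatiWeight (T : ℕ) (A : ℕ → Matrix m m ℝ) (B : ℕ → Matrix m k ℝ)
    (Q : ℕ → Matrix m m ℝ) (R : ℕ → Matrix k k ℝ) (t : ℕ) : Matrix k k ℝ :=
  (B t)ᵀ * riccati T A B Q R (t + 1) * B t + R t

theorem riccatiWeight_posSemidef (hQ : ∀ t ∈ Finset.Icc 1 T, (Q t).PosSemidef)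
    (hR : ∀ t ∈ Finset.Icc 1 T, (R t).PosDef) {t : ℕ} (ht : t ∈ Finset.Icc 1 T) :
    (riccatiWeight T A B Q R t).PosSemidef :=
  (posDef_conj_add (riccati_posSemidef hQ hR (by omega)) _ (hR t ht)).posSemidef

/-- The linear-quadratic cost along a trajectory: the Riccati value of the initial state, plus the
squares by which the input deviates from the optimal feedback, plus the contribution of the noise,
plus cross terms between the noise and the noiseless prediction of the next state. -/
theorem lq_identity (hQ : ∀ t ∈ Finset.Icc 1 T, (Q t).PosSemidef)
    (hR : ∀ t ∈ Finset.Icc 1 T, (R t).PosDef) (y ξ : ℕ → m → ℝ) (v : ℕ → k → ℝ)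
    (hy : ∀ t ∈ Finset.Icc 1 T, y (t + 1) = A t *ᵥ y t + B t *ᵥ v t + ξ t) :
    ∑ t ∈ Finset.Icc 1 T, (qform (Q t) (y t) + qform (R t) (v t))
      = qform (riccati T A B Q R 1) (y 1)
        + ∑ t ∈ Finset.Icc 1 T,
          (qform (riccatiWeight T A B Q R t) (v t - riccatiGain T A B Q R t *ᵥ y t)
            + qform (riccati T A B Q R (t + 1)) (ξ t)
            + 2 * ((A t *ᵥ y t + B t *ᵥ v t) ⬝ᵥ (riccati T A B Q R (t + 1) *ᵥ ξ t))) := by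
  have key : ∀ N ≤ T, ∑ t ∈ Finset.Icc 1 N, (qform (Q t) (y t) + qform (R t) (v t))
      = qform (riccati T A B Q R 1) (y 1) - qform (riccati T A B Q R (N + 1)) (y (N + 1))
        + ∑ t ∈ Finset.Icc 1 N,
          (qform (riccatiWeight T A B Q R t) (v t - riccatiGain T A B Q R t *ᵥ y t)
            + qform (riccati T A B Q R (t + 1)) (ξ t)
            + 2 * ((A t *ᵥ y t + B t *ᵥ v t) ⬝ᵥ (riccati T A B Q R (t + 1) *ᵥ ξ t))) := by
    intro N
    induction N with
    | zero => intro _; simp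
    | succ N ih =>
      intro hN
      have hmem : N + 1 ∈ Finset.Icc 1 T := by simp only [Finset.mem_Icc]; omega
      have hM : (riccati T A B Q R (N + 1 + 1)).PosSemidef :=
        riccati_posSemidef hQ hR (by omega)
      have h1 := qform_riccatiStep (A (N + 1)) (B (N + 1)) (Q (N + 1)) hM (hR _ hmem)
        (y (N + 1)) (v (N + 1))
      rw [← riccati_eq T A B Q R hN] at h1
      rw [Finset.sum_Icc_succ_top (by omega), Finset.sum_Icc_succ_top (by omega),
        ih (by omega), hy (N + 1) hmem, qform_add hM.isSymm]
      simp only [riccatiWeight, riccatiGain]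
      linarith
  have h := key T le_rfl
  rw [riccati_terminal] at h
  rw [h]
  simp [qform]

end QuadraticForm

/-! ### The mean-field and the splitting of the cost -/

section MeanField

variable {d n : ℕ}

theorem meanField_add (x y : Fin n → Vec d) :
    meanField (fun i => x i + y i) = meanField x + meanField y := by
  simp [meanField, Finset.sum_add_distrib, smul_add]

theorem meanField_sub (x y : Fin n → Vec d) :
    meanField (fun i => x i - y i) = meanField x - meanField y := by
  simp [meanField, Finset.sum_sub_distrib, smul_sub]

theorem meanField_mulVec {d' : ℕ} (M : Matrix (Fin d') (Fin d) ℝ) (x : Fin n → Vec d) :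
    meanField (fun i => M *ᵥ x i) = M *ᵥ meanField x := by
  simp only [meanField, mulVec_smul]
  congr 1
  exact (map_sum (mulVecLin M) x Finset.univ).symm

theorem meanField_const (hn : 1 ≤ n) (a : Vec d) : meanField (fun _ : Fin n => a) = a := by
  have : (n : ℝ) ≠ 0 := by positivity
  simp only [meanField, Finset.sum_const, Finset.card_univ, Fintype.card_fin]
  rw [← Nat.cast_smul_eq_nsmul ℝ, smul_smul, inv_mul_cancel₀ this, one_smul]

theorem sum_sub_meanField (hn : 1 ≤ n) (x : Fin n → Vec d) :
    ∑ i, (x i - meanField x) = 0 := by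
  have hn' : (n : ℝ) ≠ 0 := by positivity
  have h : meanField (fun i => x i - meanField x) = 0 := by
    rw [meanField_sub, meanField_const hn, sub_self]
  simpa [meanField, hn'] using h

/-- Parallel-axis identity: the average of a quadratic form around an arbitrary point. -/
theorem average_qform_sub (hn : 1 ≤ n) {M : Matrix (Fin d) (Fin d) ℝ} (hM : M.IsSymm)
    (x : Fin n → Vec d) (ρ : Vec d) :
    1 / (n : ℝ) * ∑ i, qform M (x i - ρ)
      = qform M (meanField x - ρ) + 1 / (n : ℝ) * ∑ i, qform M (x i - meanField x) := by
  have hn' : (n : ℝ) ≠ 0 := by positivity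
  have h : ∀ i, qform M (x i - ρ) = qform M (x i - meanField x) + qform M (meanField x - ρ)
      + 2 * ((x i - meanField x) ⬝ᵥ (M *ᵥ (meanField x - ρ))) := fun i => by
    rw [← qform_add hM, sub_add_sub_cancel]
  simp_rw [h, Finset.sum_add_distrib, ← Finset.mul_sum, ← sum_dotProduct,
    sum_sub_meanField hn]
  simp only [zero_dotProduct, Finset.sum_const, Finset.card_univ, Fintype.card_fin, nsmul_eq_mul]
  field_simp
  ring

theorem average_qform (hn : 1 ≤ n) {M : Matrix (Fin d) (Fin d) ℝ} (hM : M.IsSymm)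
    (x : Fin n → Vec d) :
    1 / (n : ℝ) * ∑ i, qform M (x i)
      = qform M (meanField x) + 1 / (n : ℝ) * ∑ i, qform M (x i - meanField x) := by
  simpa using average_qform_sub hn hM x 0

theorem average_qform_pair (hn : 1 ≤ n) {M : Matrix (Fin d) (Fin d) ℝ} (hM : M.IsSymm)
    (x : Fin n → Vec d) :
    1 / (2 * (n : ℝ) ^ 2) * ∑ i, ∑ j, qform M (x i - x j)
      = 1 / (n : ℝ) * ∑ i, qform M (x i - meanField x) := by
  have hn' : (n : ℝ) ≠ 0 := by positivity
  have h : ∀ i, ∑ j, qform M (x i - x j) = n * qform M (x i - meanField x)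
      + ∑ j, qform M (x j - meanField x) := fun i => by
    have := average_qform_sub hn hM x (x i)
    simp_rw [qform_sub_comm M (x i)]
    field_simp at this
    exact this
  simp_rw [h, Finset.sum_add_distrib, ← Finset.mul_sum]
  simp only [Finset.sum_const, Finset.card_univ, Fintype.card_fin, nsmul_eq_mul]
  field_simp
  ring

end MeanField

namespace Network

variable {dx du n : ℕ} (S : Network dx du)

theorem qform_Qbar {t : ℕ} (ht : t ∈ Finset.Icc 1 S.T) (hS : S.Admissible) (ρ x : Vec dx) :
    qform (S.Qbar t) (Sum.elim ρ x)
      = qform (S.Q t) x + qform (S.P t) (x - ρ) + qform (S.F t) (x - ρ) := by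
  obtain ⟨-, hP, hF, -, -⟩ := hS.symm t ht
  rw [qform_sub hP, qform_sub hF]
  have e : -S.P t - S.F t = -(S.P t + S.F t) := by abel
  simp only [qform, Qbar, e, fromBlocks_mulVec, Function.comp_def, Sum.elim_inl, Sum.elim_inr,
    sumElim_dotProduct_sumElim, neg_mulVec, add_mulVec, dotProduct_add, dotProduct_neg]
  rw [dotProduct_mulVec_symm hP ρ x, dotProduct_mulVec_symm hF ρ x]
  ring

/-- The cost of deviations from the mean-field. -/
noncomputable def deviationCost (x : ℕ → Fin n → Vec dx) (u : ℕ → Fin n → Vec du) (i : Fin n) : ℝ :=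
  ∑ t ∈ Finset.Icc 1 S.T, (qform (S.Q t + S.P t + S.H t) (x t i - meanField (x t))
    + qform (S.R t) (u t i - meanField (u t)))

/-- The cost of the pair (target, mean-field). -/
noncomputable def jointCost (ρ : Vec dx) (x : ℕ → Fin n → Vec dx) (u : ℕ → Fin n → Vec du) : ℝ :=
  ∑ t ∈ Finset.Icc 1 S.T, (qform (S.Qbar t) (Sum.elim ρ (meanField (x t)))
    + qform (S.R t) (meanField (u t)))

/-- The cost decouples into the mean-field and the deviations from it. -/
theorem cost_eq (hS : S.Admissible) (hn : 1 ≤ n) (ρ : Vec dx) (x : ℕ → Fin n → Vec dx)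
    (u : ℕ → Fin n → Vec du) :
    S.cost ρ x u = 1 / (n : ℝ) * ∑ i, S.deviationCost x u i + S.jointCost ρ x u := by
  simp only [cost, deviationCost, jointCost, quad_eq_qform]
  rw [Finset.sum_comm, Finset.mul_sum, ← Finset.sum_add_distrib]
  refine Finset.sum_congr rfl fun t ht => ?_
  obtain ⟨hQ, hP, hF, hH, hR⟩ := hS.symm t ht
  rw [average_qform_pair hn hH, S.qform_Qbar ht hS]
  simp_rw [Finset.sum_add_distrib, mul_add, qform_matrix_add, Finset.sum_add_distrib, mul_add]
  rw [average_qform hn hQ, average_qform_sub hn hP, average_qform hn hR]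
  ring

/-- The cost bounds the cost of the inputs. -/
theorem sum_qform_input_le_cost (hS : S.Admissible) (hn : 1 ≤ n) (ρ : Vec dx)
    (x : ℕ → Fin n → Vec dx) (u : ℕ → Fin n → Vec du) :
    ∑ t ∈ Finset.Icc 1 S.T, 1 / (n : ℝ) * ∑ i, qform (S.R t) (u t i) ≤ S.cost ρ x u := by
  rw [S.cost_eq hS hn]
  simp only [deviationCost, jointCost]
  rw [Finset.sum_comm, Finset.mul_sum, ← Finset.sum_add_distrib]
  refine Finset.sum_le_sum fun t ht => ?_
  rw [average_qform hn (hS.symm t ht).2.2.2.2, Finset.sum_add_distrib, mul_add]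
  have h1 : 0 ≤ 1 / (n : ℝ) *
      ∑ i, qform (S.Q t + S.P t + S.H t) (x t i - meanField (x t)) :=
    mul_nonneg (by positivity) (Finset.sum_nonneg fun i _ =>
      (hS.deviation_posSemidef t ht).qform_nonneg _)
  have h2 := (hS.joint_posSemidef t ht).qform_nonneg (Sum.elim ρ (meanField (x t)))
  linarith

theorem cost_nonneg (hS : S.Admissible) (hn : 1 ≤ n) (ρ : Vec dx)
    (x : ℕ → Fin n → Vec dx) (u : ℕ → Fin n → Vec du) : 0 ≤ S.cost ρ x u :=
  (Finset.sum_nonneg fun t ht => mul_nonneg (by positivity) (Finset.sum_nonneg fun _ _ =>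
    (hS.input_posDef t ht).posSemidef.qform_nonneg _)).trans
    (S.sum_qform_input_le_cost hS hn ρ x u)

/-- Changing the target changes the cost by terms that involve the mean-field only. -/
theorem cost_sub_cost (hS : S.Admissible) (hn : 1 ≤ n) (ρ r : Vec dx) (x : ℕ → Fin n → Vec dx)
    (u : ℕ → Fin n → Vec du) :
    S.cost ρ x u = S.cost r x u + ∑ t ∈ Finset.Icc 1 S.T,
      (qform (S.P t + S.F t) (ρ - r)
        - 2 * ((meanField (x t) - r) ⬝ᵥ ((S.P t + S.F t) *ᵥ (ρ - r)))) := by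
  rw [S.cost_eq hS hn, S.cost_eq hS hn, add_assoc]
  congr 1
  simp only [jointCost]
  rw [← Finset.sum_add_distrib]
  refine Finset.sum_congr rfl fun t ht => ?_
  obtain ⟨-, hP, hF, -, -⟩ := hS.symm t ht
  have e : meanField (x t) - ρ = (meanField (x t) - r) - (ρ - r) := by abel
  rw [S.qform_Qbar ht hS, S.qform_Qbar ht hS, e, qform_sub hP, qform_sub hF, qform_matrix_add,
    add_mulVec, dotProduct_add]
  ring

end Network

/-! ### Square-integrable random vectors -/

section RandomVectors

variable {m k : Type} [Fintype m] [Fintype k] {Ω : Type*} [MeasurableSpace Ω] {μ : Measure Ω}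

theorem MeasureTheory.MemLp.matrix_mulVec {X : Ω → m → ℝ} {p : ENNReal} (hX : MemLp X p μ)
    (N : Matrix k m ℝ) : MemLp (fun ω => N *ᵥ X ω) p μ :=
  (LinearMap.toContinuousLinearMap (mulVecLin N)).comp_memLp' hX

theorem measurable_matrix_mulVec (N : Matrix k m ℝ) : Measurable fun x : m → ℝ => N *ᵥ x :=
  (LinearMap.toContinuousLinearMap (mulVecLin N)).continuous.measurable

theorem integrable_dotProduct {X Y : Ω → m → ℝ} (hX : MemLp X 2 μ) (hY : MemLp Y 2 μ) :
    Integrable (fun ω => X ω ⬝ᵥ Y ω) μ :=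
  integrable_finsetSum _ fun a _ => (hX.eval a).integrable_mul (hY.eval a)

theorem integrable_bilin {X : Ω → m → ℝ} {Y : Ω → k → ℝ} (hX : MemLp X 2 μ) (hY : MemLp Y 2 μ)
    (N : Matrix m k ℝ) : Integrable (fun ω => X ω ⬝ᵥ (N *ᵥ Y ω)) μ :=
  integrable_dotProduct hX (hY.matrix_mulVec N)

theorem integrable_qform {X : Ω → m → ℝ} (hX : MemLp X 2 μ) (M : Matrix m m ℝ) :
    Integrable (fun ω => qform M (X ω)) μ :=
  integrable_bilin hX hX M

theorem memLp_sumElim {X : Ω → m → ℝ} {Y : Ω → k → ℝ} (hX : MemLp X 2 μ) (hY : MemLp Y 2 μ) :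
    MemLp (fun ω => Sum.elim (X ω) (Y ω)) 2 μ :=
  .of_eval fun a => by
    cases a with
    | inl a => exact hX.eval a
    | inr a => exact hY.eval a

theorem memLp_meanField {d n : ℕ} {X : Fin n → Ω → Vec d} (hX : ∀ i, MemLp (X i) 2 μ) :
    MemLp (fun ω => meanField fun i => X i ω) 2 μ := by
  simp only [meanField]
  exact (memLp_finsetSum _ fun i _ => hX i).const_smul (n : ℝ)⁻¹

theorem integral_matrix_mulVec {X : Ω → m → ℝ} (hX : Integrable X μ) (N : Matrix k m ℝ) :
    ∫ ω, N *ᵥ X ω ∂μ = N *ᵥ ∫ ω, X ω ∂μ :=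
  (LinearMap.toContinuousLinearMap (mulVecLin N)).integral_comp_comm hX

theorem integral_const_dotProduct {X : Ω → m → ℝ} (hX : Integrable X μ) (a : m → ℝ) :
    ∫ ω, a ⬝ᵥ X ω ∂μ = a ⬝ᵥ ∫ ω, X ω ∂μ := by
  have h : ∀ i, Integrable (fun ω => X ω i) μ := fun i => hX.eval i
  simp only [dotProduct]
  rw [integral_finsetSum _ fun i _ => (h i).const_mul _]
  exact Finset.sum_congr rfl fun i _ => by rw [integral_const_mul, eval_integral h]

theorem ProbabilityTheory.IndepFun.integral_bilin_eq_zero [IsProbabilityMeasure μ]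
    {X : Ω → m → ℝ} {Y : Ω → k → ℝ}
    (h : IndepFun X Y μ) (hX : MemLp X 2 μ) (hY : MemLp Y 2 μ) (hY0 : ∫ ω, Y ω ∂μ = 0)
    (N : Matrix m k ℝ) : ∫ ω, X ω ⬝ᵥ (N *ᵥ Y ω) ∂μ = 0 := by
  have hNY := hY.matrix_mulVec N
  have hNY0 : ∫ ω, N *ᵥ Y ω ∂μ = 0 := by
    rw [integral_matrix_mulVec (hY.integrable (by norm_num)), hY0, mulVec_zero]
  simp only [dotProduct]
  have hi : ∀ a, Integrable (fun ω => X ω a * (N *ᵥ Y ω) a) μ := fun a =>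
    (hX.eval a).integrable_mul (hNY.eval a)
  rw [integral_finsetSum _ fun a _ => hi a]
  refine Finset.sum_eq_zero fun a _ => ?_
  have hind : IndepFun (fun ω => X ω a) (fun ω => (N *ᵥ Y ω) a) μ :=
    h.comp (measurable_pi_apply a) ((measurable_pi_apply a).comp (measurable_matrix_mulVec N))
  rw [hind.integral_fun_mul_eq_mul_integral (hX.eval a).1 (hNY.eval a).1,
    ← eval_integral (fun i => (hNY.eval i).integrable (by norm_num)), hNY0]
  simp

/-- The expected linear-quadratic cost when the noise is centered and independent of the present
state and input: the cross terms average out. -/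
theorem integral_lq [DecidableEq k] [IsProbabilityMeasure μ] {T : ℕ} {A : ℕ → Matrix m m ℝ}
    {B : ℕ → Matrix m k ℝ} {Q : ℕ → Matrix m m ℝ} {R : ℕ → Matrix k k ℝ}
    (hQ : ∀ t ∈ Finset.Icc 1 T, (Q t).PosSemidef)
    (hR : ∀ t ∈ Finset.Icc 1 T, (R t).PosDef) (y ξ : ℕ → Ω → m → ℝ) (v : ℕ → Ω → k → ℝ)
    (hdyn : ∀ t ∈ Finset.Icc 1 T, ∀ ω, y (t + 1) ω = A t *ᵥ y t ω + B t *ᵥ v t ω + ξ t ω)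
    (hy : ∀ t ∈ Finset.Icc 1 (T + 1), MemLp (y t) 2 μ)
    (hv : ∀ t ∈ Finset.Icc 1 T, MemLp (v t) 2 μ)
    (hξ : ∀ t ∈ Finset.Icc 1 T, MemLp (ξ t) 2 μ)
    (hξ0 : ∀ t ∈ Finset.Icc 1 T, ∫ ω, ξ t ω ∂μ = 0)
    (hind : ∀ t ∈ Finset.Icc 1 T,
      IndepFun (fun ω => A t *ᵥ y t ω + B t *ᵥ v t ω) (ξ t) μ) :
    ∫ ω, ∑ t ∈ Finset.Icc 1 T, (qform (Q t) (y t ω) + qform (R t) (v t ω)) ∂μ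
      = (∫ ω, qform (riccati T A B Q R 1) (y 1 ω) ∂μ)
        + ∑ t ∈ Finset.Icc 1 T, ∫ ω, qform (riccati T A B Q R (t + 1)) (ξ t ω) ∂μ
        + ∑ t ∈ Finset.Icc 1 T, ∫ ω, qform (riccatiWeight T A B Q R t)
            (v t ω - riccatiGain T A B Q R t *ᵥ y t ω) ∂μ := by
  have hy' : ∀ t ∈ Finset.Icc 1 T, MemLp (y t) 2 μ := fun t ht =>
    hy t (Finset.Icc_subset_Icc le_rfl (Nat.le_succ T) ht)
  have hp : ∀ t ∈ Finset.Icc 1 T, MemLp (fun ω => A t *ᵥ y t ω + B t *ᵥ v t ω) 2 μ :=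
    fun t ht => ((hy' t ht).matrix_mulVec (A t)).add ((hv t ht).matrix_mulVec (B t))
  let f₁ : ℕ → Ω → ℝ := fun t ω => qform (riccatiWeight T A B Q R t)
    (v t ω - riccatiGain T A B Q R t *ᵥ y t ω)
  let f₂ : ℕ → Ω → ℝ := fun t ω => qform (riccati T A B Q R (t + 1)) (ξ t ω)
  let f₃ : ℕ → Ω → ℝ := fun t ω =>
    (A t *ᵥ y t ω + B t *ᵥ v t ω) ⬝ᵥ (riccati T A B Q R (t + 1) *ᵥ ξ t ω)
  have i₁ : ∀ t ∈ Finset.Icc 1 T, Integrable (f₁ t) μ := fun t ht =>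
    integrable_qform ((hv t ht).sub ((hy' t ht).matrix_mulVec (riccatiGain T A B Q R t)))
      (riccatiWeight T A B Q R t)
  have i₂ : ∀ t ∈ Finset.Icc 1 T, Integrable (f₂ t) μ := fun t ht => integrable_qform (hξ t ht) (riccati T A B Q R (t + 1))
  have i₃ : ∀ t ∈ Finset.Icc 1 T, Integrable (f₃ t) μ := fun t ht =>
    integrable_bilin (hp t ht) (hξ t ht) (riccati T A B Q R (t + 1))
  have i₄ : ∀ t ∈ Finset.Icc 1 T, Integrable (fun ω => f₁ t ω + f₂ t ω + 2 * f₃ t ω) μ :=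
    fun t ht => ((i₁ t ht).add (i₂ t ht)).add ((i₃ t ht).const_mul 2)
  have h1 : ∀ ω, ∑ t ∈ Finset.Icc 1 T, (qform (Q t) (y t ω) + qform (R t) (v t ω))
      = qform (riccati T A B Q R 1) (y 1 ω)
        + ∑ t ∈ Finset.Icc 1 T, (f₁ t ω + f₂ t ω + 2 * f₃ t ω) := fun ω =>
    lq_identity hQ hR (fun t => y t ω) (fun t => ξ t ω) (fun t => v t ω) fun t ht => hdyn t ht ω
  have h2 : ∀ t ∈ Finset.Icc 1 T, ∫ ω, (f₁ t ω + f₂ t ω + 2 * f₃ t ω) ∂μ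
      = (∫ ω, f₂ t ω ∂μ) + ∫ ω, f₁ t ω ∂μ := fun t ht => by
    have h0 : ∫ ω, f₃ t ω ∂μ = 0 :=
      (hind t ht).integral_bilin_eq_zero (hp t ht) (hξ t ht) (hξ0 t ht)
        (riccati T A B Q R (t + 1))
    have i₁₂ : Integrable (fun ω => f₁ t ω + f₂ t ω) μ := (i₁ t ht).add (i₂ t ht)
    rw [integral_add i₁₂ ((i₃ t ht).const_mul 2),
      integral_add (i₁ t ht) (i₂ t ht), integral_const_mul, h0]
    ring
  rw [integral_congr_ae (ae_of_all _ h1), integral_add (integrable_qform (hy 1 (by simp)) _)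
    (integrable_finsetSum _ i₄), integral_finsetSum _ i₄, Finset.sum_congr rfl h2,
    Finset.sum_add_distrib, add_assoc]

end RandomVectors

section Bounds

variable {m k : Type} [Fintype m] [Fintype k]

theorem abs_bilin_le (N : Matrix m k ℝ) (x : m → ℝ) (y : k → ℝ) :
    |x ⬝ᵥ (N *ᵥ y)| ≤ (∑ a, ∑ b, |N a b|) * (‖x‖ * ‖y‖) := by
  simp only [dotProduct, mulVec, Finset.mul_sum, Finset.sum_mul]
  refine (Finset.abs_sum_le_sum_abs _ _).trans (Finset.sum_le_sum fun a _ => ?_)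
  refine (Finset.abs_sum_le_sum_abs _ _).trans (Finset.sum_le_sum fun b _ => ?_)
  rw [abs_mul, abs_mul, mul_left_comm]
  have h1 := norm_le_pi_norm x a
  have h2 := norm_le_pi_norm y b
  rw [Real.norm_eq_abs] at h1 h2
  gcongr

theorem Matrix.PosDef.exists_coercive {R : Matrix k k ℝ} (hR : R.PosDef) :
    ∃ c > 0, ∀ v, c * ‖v‖ ^ 2 ≤ qform R v := by
  -- the minimum of the form on the unit sphere; the sphere is empty when `k` is
  have hcont : Continuous (qform R) :=
    continuous_id.dotProduct (LinearMap.toContinuousLinearMap (mulVecLin R)).continuous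
  rcases (Metric.sphere (0 : k → ℝ) 1).eq_empty_or_nonempty with h0 | hne
  · refine ⟨1, one_pos, fun v => ?_⟩
    have hv : v = 0 := by
      by_contra hv
      have : ‖v‖⁻¹ • v ∈ Metric.sphere (0 : k → ℝ) 1 := by simp [norm_smul, hv]
      simp [h0] at this
    simp [hv]
  · obtain ⟨v₀, hv₀, hmin⟩ := (isCompact_sphere (0 : k → ℝ) 1).exists_isMinOn hne
      hcont.continuousOn
    have hv₀0 : v₀ ≠ 0 := by rintro rfl; simp at hv₀
    refine ⟨qform R v₀, by simpa [qform] using hR.dotProduct_mulVec_pos hv₀0, fun v => ?_⟩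
    by_cases hv : v = 0
    · simp [hv]
    have hm : ‖v‖⁻¹ • v ∈ Metric.sphere (0 : k → ℝ) 1 := by simp [norm_smul, hv]
    have h1 : qform R v₀ ≤ qform R (‖v‖⁻¹ • v) := hmin hm
    have h2 : qform R (‖v‖⁻¹ • v) = ‖v‖⁻¹ ^ 2 * qform R v := by
      simp only [qform, mulVec_smul, dotProduct_smul, smul_dotProduct, smul_eq_mul]; ring
    have h3 : 0 < ‖v‖ := norm_pos_iff.2 hv
    rw [h2] at h1
    calc qform R v₀ * ‖v‖ ^ 2 ≤ ‖v‖⁻¹ ^ 2 * qform R v * ‖v‖ ^ 2 := by gcongr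
      _ = qform R v := by field_simp

theorem norm_sq_le_sum_sq (x : m → ℝ) : ‖x‖ ^ 2 ≤ ∑ a, x a ^ 2 := by
  have h0 : 0 ≤ ∑ a, x a ^ 2 := Finset.sum_nonneg fun a _ => sq_nonneg _
  rw [← Real.sqrt_le_sqrt_iff h0, Real.sqrt_sq (norm_nonneg _), pi_norm_le_iff_of_nonneg
    (Real.sqrt_nonneg _)]
  intro a
  rw [Real.norm_eq_abs, ← Real.sqrt_sq_eq_abs]
  exact Real.sqrt_le_sqrt (Finset.single_le_sum (f := fun a => x a ^ 2)
    (fun a _ => sq_nonneg _) (Finset.mem_univ a))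

end Bounds

/-! ### Mean-square rate `O(1/n)` -/

section Rate

variable {m k : Type} [Fintype m] [Fintype k] {Ω : Type*} [MeasurableSpace Ω] {μ : Measure Ω}

/-- The second moment of `X n` is `O(1/n)`, with a constant valid for all `n ≥ 1`. -/
def SqMeanRate (μ : Measure Ω) (X : ℕ → Ω → m → ℝ) : Prop :=
  (∀ n, 1 ≤ n → MemLp (X n) 2 μ) ∧ ∃ C : ℝ, ∀ n : ℕ, 1 ≤ n → ∫ ω, ‖X n ω‖ ^ 2 ∂μ ≤ C / n

theorem integrable_norm_sq {X : Ω → m → ℝ} (hX : MemLp X 2 μ) :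
    Integrable (fun ω => ‖X ω‖ ^ 2) μ :=
  (memLp_two_iff_integrable_sq_norm hX.1).1 hX

namespace SqMeanRate

theorem congr {X Y : ℕ → Ω → m → ℝ} (hX : SqMeanRate μ X)
    (h : ∀ n, 1 ≤ n → ∀ ω, Y n ω = X n ω) : SqMeanRate μ Y := by
  have h' : ∀ n, 1 ≤ n → Y n = X n := fun n hn => funext (h n hn)
  refine ⟨fun n hn => h' n hn ▸ hX.1 n hn, ?_⟩
  obtain ⟨C, hC⟩ := hX.2
  exact ⟨C, fun n hn => h' n hn ▸ hC n hn⟩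

theorem add {X Y : ℕ → Ω → m → ℝ} (hX : SqMeanRate μ X) (hY : SqMeanRate μ Y) :
    SqMeanRate μ (fun n ω => X n ω + Y n ω) := by
  refine ⟨fun n hn => (hX.1 n hn).add (hY.1 n hn), ?_⟩
  obtain ⟨C, hC⟩ := hX.2
  obtain ⟨D, hD⟩ := hY.2
  refine ⟨2 * C + 2 * D, fun n hn => ?_⟩
  have iX := integrable_norm_sq (hX.1 n hn)
  have iY := integrable_norm_sq (hY.1 n hn)
  calc ∫ ω, ‖X n ω + Y n ω‖ ^ 2 ∂μ ≤ ∫ ω, (2 * ‖X n ω‖ ^ 2 + 2 * ‖Y n ω‖ ^ 2) ∂μ := by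
        refine integral_mono (integrable_norm_sq ((hX.1 n hn).add (hY.1 n hn)))
          ((iX.const_mul 2).add (iY.const_mul 2)) fun ω => ?_
        have h := norm_add_le (X n ω) (Y n ω)
        have h0 := norm_nonneg (X n ω + Y n ω)
        simp only
        nlinarith [sq_nonneg (‖X n ω‖ - ‖Y n ω‖)]
    _ = 2 * (∫ ω, ‖X n ω‖ ^ 2 ∂μ) + 2 * ∫ ω, ‖Y n ω‖ ^ 2 ∂μ := by
        rw [integral_add (iX.const_mul 2) (iY.const_mul 2), integral_const_mul,
          integral_const_mul]
    _ ≤ 2 * (C / n) + 2 * (D / n) := by gcongr <;> [exact hC n hn; exact hD n hn]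
    _ = (2 * C + 2 * D) / n := by ring

theorem mulVec {X : ℕ → Ω → m → ℝ} (hX : SqMeanRate μ X) (N : Matrix k m ℝ) :
    SqMeanRate μ (fun n ω => N *ᵥ X n ω) := by
  refine ⟨fun n hn => (hX.1 n hn).matrix_mulVec N, ?_⟩
  obtain ⟨C, hC⟩ := hX.2
  set L := LinearMap.toContinuousLinearMap (mulVecLin N)
  refine ⟨‖L‖ ^ 2 * C, fun n hn => ?_⟩
  calc ∫ ω, ‖N *ᵥ X n ω‖ ^ 2 ∂μ ≤ ∫ ω, ‖L‖ ^ 2 * ‖X n ω‖ ^ 2 ∂μ := by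
        refine integral_mono (integrable_norm_sq ((hX.1 n hn).matrix_mulVec N))
          ((integrable_norm_sq (hX.1 n hn)).const_mul _) fun ω => ?_
        have h : ‖N *ᵥ X n ω‖ ≤ ‖L‖ * ‖X n ω‖ := L.le_opNorm (X n ω)
        simp only
        rw [← mul_pow]
        gcongr
    _ = ‖L‖ ^ 2 * ∫ ω, ‖X n ω‖ ^ 2 ∂μ := integral_const_mul _ _
    _ ≤ ‖L‖ ^ 2 * (C / n) := by gcongr; exact hC n hn
    _ = ‖L‖ ^ 2 * C / n := by ring

/-- Bilinear expressions in vectors with mean-square rate `O(1/n)` have mean `O(1/n)`. -/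
theorem integral_bilin {X : ℕ → Ω → m → ℝ} {Y : ℕ → Ω → k → ℝ} (hX : SqMeanRate μ X)
    (hY : SqMeanRate μ Y) (N : Matrix m k ℝ) :
    ∃ C : ℝ, ∀ n : ℕ, 1 ≤ n → |∫ ω, X n ω ⬝ᵥ (N *ᵥ Y n ω) ∂μ| ≤ C / n := by
  obtain ⟨C, hC⟩ := hX.2
  obtain ⟨D, hD⟩ := hY.2
  set K := ∑ a, ∑ b, |N a b|
  have hK : 0 ≤ K := Finset.sum_nonneg fun a _ => Finset.sum_nonneg fun b _ => abs_nonneg _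
  refine ⟨K * (C + D), fun n hn => ?_⟩
  have iX := integrable_norm_sq (hX.1 n hn)
  have iY := integrable_norm_sq (hY.1 n hn)
  calc |∫ ω, X n ω ⬝ᵥ (N *ᵥ Y n ω) ∂μ| ≤ ∫ ω, |X n ω ⬝ᵥ (N *ᵥ Y n ω)| ∂μ :=
        abs_integral_le_integral_abs
    _ ≤ ∫ ω, K * (‖X n ω‖ ^ 2 + ‖Y n ω‖ ^ 2) ∂μ := by
        refine integral_mono (integrable_bilin (hX.1 n hn) (hY.1 n hn) N).abs
          ((iX.add iY).const_mul K) fun ω => (abs_bilin_le N _ _).trans ?_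
        gcongr
        nlinarith [sq_nonneg (‖X n ω‖ - ‖Y n ω‖), sq_nonneg (‖X n ω‖), sq_nonneg (‖Y n ω‖)]
    _ = K * ((∫ ω, ‖X n ω‖ ^ 2 ∂μ) + ∫ ω, ‖Y n ω‖ ^ 2 ∂μ) := by
        rw [integral_const_mul, integral_add iX iY]
    _ ≤ K * (C / n + D / n) := by gcongr <;> [exact hC n hn; exact hD n hn]
    _ = K * (C + D) / n := by ring

end SqMeanRate

/-- The empirical mean of independent identically distributed square-integrable vectors has
mean-square error `O(1/n)`. -/
theorem sqMeanRate_meanField [IsProbabilityMeasure μ] {d : ℕ} {X : ℕ → Ω → Vec d} {a : Vec d}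
    (hind : Pairwise fun i j => IndepFun (X i) (X j) μ)
    (hid : ∀ i, IdentDistrib (X i) (X 0) μ μ) (hX : MemLp (X 0) 2 μ) (ha : ∫ ω, X 0 ω ∂μ = a) :
    SqMeanRate μ (fun n ω => meanField (fun i : Fin n => X i ω) - a) := by
  have hXi : ∀ i, MemLp (X i) 2 μ := fun i => (hid i).memLp_iff.2 hX
  have hmem : ∀ n : ℕ, MemLp (fun ω => meanField (fun i : Fin n => X i ω) - a) 2 μ := fun n =>
    (memLp_meanField fun i => hXi i).sub (memLp_const a)
  refine ⟨fun n _ => hmem n, ∑ b, Var[fun ω => X 0 ω b; μ], fun n hn => ?_⟩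
  have hn' : (n : ℝ) ≠ 0 := by positivity
  have hidb : ∀ i b, IdentDistrib (fun ω => X i ω b) (fun ω => X 0 ω b) μ μ := fun i b =>
    (hid i).comp (measurable_pi_apply b)
  have hEb : ∀ b, ∫ ω, X 0 ω b ∂μ = a b := fun b => by
    rw [← ha, eval_integral fun i => (hX.eval i).integrable (by norm_num)]
  have hcoord : ∀ b, ∫ ω, (meanField (fun i : Fin n => X i ω) - a) b ^ 2 ∂μ
      = Var[fun ω => X 0 ω b; μ] / n := fun b => by
    have hm : ∀ i : Fin n, MemLp (fun ω => X i ω b) 2 μ := fun i => (hXi i).eval b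
    have hsum : MemLp (∑ i : Fin n, fun ω => X i ω b) 2 μ := memLp_finsetSum' _ fun i _ => hm i
    have hE : ∫ ω, (∑ i : Fin n, fun ω => X i ω b) ω ∂μ = n * a b := by
      simp only [Finset.sum_apply]
      rw [integral_finsetSum _ fun i _ => (hm i).integrable (by norm_num)]
      simp [(hidb _ b).integral_eq, hEb]
    have hV : Var[∑ i : Fin n, fun ω => X i ω b; μ] = n * Var[fun ω => X 0 ω b; μ] := by
      rw [IndepFun.variance_sum fun i _ => hm i]
      · simp [(hidb _ b).variance_eq]
      · intro i _ j _ hij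
        exact (hind (fun h => hij (Fin.ext h))).comp (measurable_pi_apply b)
          (measurable_pi_apply b)
    rw [variance_eq_integral hsum.1.aemeasurable, hE] at hV
    have h1 : ∀ ω, (meanField (fun i : Fin n => X i ω) - a) b ^ 2
        = (n : ℝ)⁻¹ ^ 2 * ((∑ i : Fin n, fun ω => X i ω b) ω - n * a b) ^ 2 := fun ω => by
      simp only [meanField, Pi.sub_apply, Pi.smul_apply, Finset.sum_apply, smul_eq_mul]
      field_simp
    simp_rw [h1]
    rw [integral_const_mul, hV]
    field_simp
  calc ∫ ω, ‖meanField (fun i : Fin n => X i ω) - a‖ ^ 2 ∂μ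
      ≤ ∫ ω, ∑ b, (meanField (fun i : Fin n => X i ω) - a) b ^ 2 ∂μ :=
        integral_mono (integrable_norm_sq (hmem n))
          (integrable_finsetSum _ fun b _ => ((hmem n).eval b).integrable_sq)
          fun ω => norm_sq_le_sum_sq _
    _ = ∑ b, Var[fun ω => X 0 ω b; μ] / n := by
        rw [integral_finsetSum _ fun b _ => ((hmem n).eval b).integrable_sq]
        exact Finset.sum_congr rfl fun b _ => hcoord b
    _ = _ := (Finset.sum_div _ _ _).symm

theorem ae_tendsto_meanField {d : ℕ} {X : ℕ → Ω → Vec d} {a : Vec d}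
    (hind : Pairwise fun i j => IndepFun (X i) (X j) μ)
    (hid : ∀ i, IdentDistrib (X i) (X 0) μ μ) (hX : Integrable (X 0) μ)
    (ha : ∫ ω, X 0 ω ∂μ = a) :
    ∀ᵐ ω ∂μ, Tendsto (fun n : ℕ => meanField (fun i : Fin n => X i ω)) atTop (𝓝 a) := by
  have h := strong_law_ae X hX hind hid
  rw [ha] at h
  simpa only [meanField, Finset.sum_range] using h

end Rate

/-! ### Dynamics of the mean-field and of the deviations -/

namespace Network

variable {dx du n : ℕ} (S : Network dx du)

theorem state_succ (c : Policy dx du n) (r : Vec dx) (x₁ : Fin n → Vec dx)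
    (w : ℕ → Fin n → Vec dx) {t : ℕ} (ht : 1 ≤ t) (i : Fin n) :
    S.state c r x₁ w (t + 1) i = S.A t *ᵥ S.state c r x₁ w t i
      + S.B t *ᵥ S.action c r x₁ w t i + S.D t *ᵥ meanField (S.state c r x₁ w t)
      + S.E t *ᵥ r + w t i := by
  obtain ⟨t, rfl⟩ := Nat.exists_eq_add_of_le' ht
  rfl

theorem meanField_state_succ (hn : 1 ≤ n) (c : Policy dx du n) (r : Vec dx)
    (x₁ : Fin n → Vec dx) (w : ℕ → Fin n → Vec dx) {t : ℕ} (ht : 1 ≤ t) :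
    meanField (S.state c r x₁ w (t + 1))
      = (S.A t + S.D t) *ᵥ meanField (S.state c r x₁ w t)
        + S.B t *ᵥ meanField (S.action c r x₁ w t) + S.E t *ᵥ r + meanField (w t) := by
  rw [funext fun i => S.state_succ c r x₁ w ht i]
  simp only [meanField_add, meanField_mulVec, meanField_const hn, add_mulVec]
  abel

theorem deviation_state_succ (hn : 1 ≤ n) (c : Policy dx du n) (r : Vec dx)
    (x₁ : Fin n → Vec dx) (w : ℕ → Fin n → Vec dx) {t : ℕ} (ht : 1 ≤ t) (i : Fin n) :
    S.state c r x₁ w (t + 1) i - meanField (S.state c r x₁ w (t + 1))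
      = S.A t *ᵥ (S.state c r x₁ w t i - meanField (S.state c r x₁ w t))
        + S.B t *ᵥ (S.action c r x₁ w t i - meanField (S.action c r x₁ w t))
        + (w t i - meanField (w t)) := by
  rw [S.meanField_state_succ hn c r x₁ w ht, S.state_succ c r x₁ w ht]
  simp only [mulVec_sub, add_mulVec]
  abel

theorem joint_state_succ (hn : 1 ≤ n) (c : Policy dx du n) (r : Vec dx)
    (x₁ : Fin n → Vec dx) (w : ℕ → Fin n → Vec dx) {t : ℕ} (ht : 1 ≤ t) :
    Sum.elim r (meanField (S.state c r x₁ w (t + 1)))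
      = S.Abar t *ᵥ Sum.elim r (meanField (S.state c r x₁ w t))
        + S.Bbar t *ᵥ meanField (S.action c r x₁ w t) + Sum.elim (0 : Vec dx) (meanField (w t)) := by
  rw [S.meanField_state_succ hn c r x₁ w ht]
  funext a
  cases a with
  | inl a => simp [Abar, Bbar, fromBlocks_mulVec, fromRows_mulVec]
  | inr a =>
    simp only [Abar, Bbar, fromBlocks_mulVec, fromRows_mulVec, Pi.add_apply, Sum.elim_inr,
      Function.comp_def, Sum.elim_inl]
    ring

theorem Lbar_mulVec (t : ℕ) (r x : Vec dx) :
    S.Lbar t *ᵥ Sum.elim r x = S.Lref t *ᵥ r + S.Lmean t *ᵥ x := by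
  conv_lhs => rw [← fromCols_toCols (S.Lbar t)]
  rw [fromCols_mulVec]
  rfl

/-! ### Information available at each time -/

section Measurability

variable {Ω : Type*} {x₁ : ℕ → Ω → Vec dx} {w : ℕ → ℕ → Ω → Vec dx}

theorem measurable_meanField {d : ℕ} : Measurable (meanField : (Fin n → Vec d) → Vec d) := by
  unfold meanField
  fun_prop

/-- Measurability with respect to an arbitrary σ-algebra on `Ω`: the states at time `t` use only the
reference, the initial states and the noises before time `t`. -/
theorem measurable_randomState [MeasurableSpace Ω] {c : Policy dx du n}
    (hc : ∀ t i, Measurable fun p : (Fin n → Vec dx) × Vec dx => c t i p.1 p.2)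
    {r : Ω → Vec dx} (hr : Measurable r) (hx : ∀ i, Measurable (x₁ i)) (t : ℕ)
    (hw : ∀ s < t, ∀ i, Measurable (w s i)) :
    Measurable fun ω => S.randomState x₁ w c r ω t := by
  induction t with
  | zero => exact measurable_pi_lambda _ fun i => hx i
  | succ t ih =>
    rcases Nat.eq_zero_or_pos t with rfl | ht
    · exact measurable_pi_lambda _ fun i => hx i
    have hs := ih fun s hs => hw s (hs.trans (Nat.lt_succ_self t))
    have hm := measurable_meanField.comp hs
    refine measurable_pi_lambda _ fun i => ?_
    have hsi : Measurable fun ω => S.randomState x₁ w c r ω t i :=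
      (measurable_pi_apply i).comp hs
    have ha : Measurable fun ω => S.randomAction x₁ w c r ω t i :=
      (hc t i).comp (hs.prodMk hr)
    have e : (fun ω => S.randomState x₁ w c r ω (t + 1) i) = fun ω =>
        S.A t *ᵥ S.randomState x₁ w c r ω t i + S.B t *ᵥ S.randomAction x₁ w c r ω t i
          + S.D t *ᵥ meanField (S.randomState x₁ w c r ω t) + S.E t *ᵥ r ω + w t i ω :=
      funext fun ω => S.state_succ c (r ω) _ _ ht i
    rw [e]
    exact (((((measurable_matrix_mulVec _).comp hsi).add ((measurable_matrix_mulVec _).comp ha)).add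
      ((measurable_matrix_mulVec _).comp hm)).add ((measurable_matrix_mulVec _).comp hr)).add
      (hw t (Nat.lt_succ_self t) i)

theorem measurable_randomAction [MeasurableSpace Ω] {c : Policy dx du n}
    (hc : ∀ t i, Measurable fun p : (Fin n → Vec dx) × Vec dx => c t i p.1 p.2)
    {r : Ω → Vec dx} (hr : Measurable r) (hx : ∀ i, Measurable (x₁ i)) (t : ℕ)
    (hw : ∀ s < t, ∀ i, Measurable (w s i)) :
    Measurable fun ω => S.randomAction x₁ w c r ω t :=
  measurable_pi_lambda _ fun i => (hc t i).comp ((S.measurable_randomState hc hr hx t hw).prodMk hr)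

end Measurability

end Network

section Information

variable {d : ℕ} {Ω : Type*}

/-- The information carried by the initial states. -/
@[reducible]
def initialSigma (x₁ : ℕ → Ω → Vec d) : MeasurableSpace Ω :=
  ⨆ i, MeasurableSpace.comap (x₁ i) inferInstance

/-- The information carried by the initial states and by the noises before time `t`. The primitive
variables are indexed by `ℕ ⊕ ℕ × ℕ`: followers for the initial states, (time, follower) for the
noises. -/
@[reducible]
def pastSigma (x₁ : ℕ → Ω → Vec d) (w : ℕ → ℕ → Ω → Vec d) (t : ℕ) : MeasurableSpace Ω :=
  ⨆ p ∈ {p : ℕ ⊕ ℕ × ℕ | ∀ q, p = Sum.inr q → q.1 < t},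
    MeasurableSpace.comap (Sum.elim x₁ (fun q : ℕ × ℕ => w q.1 q.2) p) inferInstance

/-- The information carried by the noises at time `t`. -/
@[reducible]
def noiseSigma (x₁ : ℕ → Ω → Vec d) (w : ℕ → ℕ → Ω → Vec d) (t : ℕ) : MeasurableSpace Ω :=
  ⨆ p ∈ {p : ℕ ⊕ ℕ × ℕ | ∃ i, p = Sum.inr (t, i)},
    MeasurableSpace.comap (Sum.elim x₁ (fun q : ℕ × ℕ => w q.1 q.2) p) inferInstance

variable {x₁ : ℕ → Ω → Vec d} {w : ℕ → ℕ → Ω → Vec d}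

theorem measurable_init_initialSigma (i : ℕ) : Measurable[initialSigma x₁] (x₁ i) :=
  measurable_iff_comap_le.2 (le_iSup (fun i => MeasurableSpace.comap (x₁ i) inferInstance) i)

theorem measurable_initialMean_initialSigma (n : ℕ) :
    Measurable[initialSigma x₁] (initialMean x₁ n) :=
  @Measurable.comp _ _ _ (initialSigma x₁) _ _ _ _ Network.measurable_meanField
    (@measurable_pi_lambda _ _ _ (initialSigma x₁) _ _
      fun i : Fin n => measurable_init_initialSigma (i : ℕ))

theorem initialSigma_le_pastSigma (t : ℕ) : initialSigma x₁ ≤ pastSigma x₁ w t :=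
  iSup_le fun i => le_iSup₂_of_le (f := fun p _ => MeasurableSpace.comap
    (Sum.elim x₁ (fun q : ℕ × ℕ => w q.1 q.2) p) inferInstance) (Sum.inl i) (by simp) le_rfl

theorem measurable_noise_pastSigma {s t : ℕ} (hst : s < t) (i : ℕ) :
    Measurable[pastSigma x₁ w t] (w s i) :=
  measurable_iff_comap_le.2 <| le_iSup₂_of_le (f := fun p _ => MeasurableSpace.comap
    (Sum.elim x₁ (fun q : ℕ × ℕ => w q.1 q.2) p) inferInstance) (Sum.inr (s, i))
    (by rintro q hq; cases hq; exact hst) le_rfl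

theorem measurable_noise_noiseSigma (t i : ℕ) : Measurable[noiseSigma x₁ w t] (w t i) :=
  measurable_iff_comap_le.2 <| le_iSup₂_of_le (f := fun p _ => MeasurableSpace.comap
    (Sum.elim x₁ (fun q : ℕ × ℕ => w q.1 q.2) p) inferInstance) (Sum.inr (t, i))
    ⟨i, rfl⟩ le_rfl

variable [MeasurableSpace Ω] {μΩ : Measure Ω} {μx : Vec d}

namespace PrimitiveVariables

theorem indep_past_noise (h : PrimitiveVariables μΩ μx x₁ w) (t : ℕ) :
    Indep (pastSigma x₁ w t) (noiseSigma x₁ w t) μΩ := by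
  refine indep_iSup_of_disjoint (fun p => ?_) h.indep.iIndep ?_
  · cases p with
    | inl i => exact (h.measurable_init i).comap_le
    | inr q => exact (h.measurable_noise q.1 q.2).comap_le
  · rw [Set.disjoint_left]
    rintro p hp ⟨i, rfl⟩
    exact lt_irrefl t (hp _ rfl)

theorem indepFun (h : PrimitiveVariables μΩ μx x₁ w) {t : ℕ} {β γ : Type*}
    [MeasurableSpace β] [MeasurableSpace γ] {f : Ω → β} {g : Ω → γ}
    (hf : Measurable[pastSigma x₁ w t] f) (hg : Measurable[noiseSigma x₁ w t] g) :
    IndepFun f g μΩ :=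
  (IndepFun_iff_Indep _ _ _).2 <| indep_of_indep_of_le_left
    (indep_of_indep_of_le_right (h.indep_past_noise t) hg.comap_le) hf.comap_le

theorem initialSigma_le (h : PrimitiveVariables μΩ μx x₁ w) :
    initialSigma x₁ ≤ (inferInstance : MeasurableSpace Ω) :=
  iSup_le fun i => (h.measurable_init i).comap_le

theorem memLp_init' (h : PrimitiveVariables μΩ μx x₁ w) (i : ℕ) : MemLp (x₁ i) 2 μΩ :=
  (h.identDistrib_init i).memLp_iff.2 h.memLp_init

theorem memLp_noise' (h : PrimitiveVariables μΩ μx x₁ w) (t i : ℕ) : MemLp (w t i) 2 μΩ :=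
  (h.identDistrib_noise t i).memLp_iff.2 (h.memLp_noise t)

theorem mean_noise' (h : PrimitiveVariables μΩ μx x₁ w) (t i : ℕ) : ∫ ω, w t i ω ∂μΩ = 0 :=
  (h.identDistrib_noise t i).integral_eq.trans (h.mean_noise t)

theorem memLp_initialMean (h : PrimitiveVariables μΩ μx x₁ w) (n : ℕ) :
    MemLp (initialMean x₁ n) 2 μΩ :=
  memLp_meanField fun i : Fin n => h.memLp_init' i

theorem pairwise_indep_init (h : PrimitiveVariables μΩ μx x₁ w) :
    Pairwise fun i j => IndepFun (x₁ i) (x₁ j) μΩ := fun i j hij =>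
  h.indep.indepFun (i := Sum.inl i) (j := Sum.inl j) (by simpa using hij)

theorem pairwise_indep_noise (h : PrimitiveVariables μΩ μx x₁ w) (t : ℕ) :
    Pairwise fun i j => IndepFun (w t i) (w t j) μΩ := fun i j hij =>
  h.indep.indepFun (i := Sum.inr (t, i)) (j := Sum.inr (t, j)) (by simpa using hij)

theorem mean_meanField_noise [IsProbabilityMeasure μΩ] (h : PrimitiveVariables μΩ μx x₁ w)
    (t n : ℕ) : ∫ ω, meanField (fun i : Fin n => w t i ω) ∂μΩ = 0 := by
  simp only [meanField]
  rw [integral_smul, integral_finsetSum _ fun (i : Fin n) _ =>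
    (h.memLp_noise' t i).integrable (by norm_num)]
  simp [h.mean_noise']

theorem mean_initialMean [IsProbabilityMeasure μΩ] (h : PrimitiveVariables μΩ μx x₁ w) {n : ℕ}
    (hn : 1 ≤ n) : ∫ ω, initialMean x₁ n ω ∂μΩ = μx := by
  have e : ∀ i, ∫ ω, x₁ i ω ∂μΩ = μx := fun i =>
    (h.identDistrib_init i).integral_eq.trans h.mean_init
  simp only [initialMean, meanField]
  rw [integral_smul, integral_finsetSum _ fun (i : Fin n) _ =>
    (h.memLp_init' i).integrable (by norm_num)]
  simp_rw [e]
  exact meanField_const hn μx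

end PrimitiveVariables

end Information

/-! ### The expected cost of a policy -/

namespace Network

variable {dx du n : ℕ} (S : Network dx du) {Ω : Type*} [MeasurableSpace Ω] {μΩ : Measure Ω}
  {μx : Vec dx} {x₁ : ℕ → Ω → Vec dx} {w : ℕ → ℕ → Ω → Vec dx}

/-- Square-integrable inputs give square-integrable states. -/
theorem memLp_randomState (h : PrimitiveVariables μΩ μx x₁ w) {c : Policy dx du n}
    {r : Ω → Vec dx} (hr : MemLp r 2 μΩ)
    (hu : ∀ t ∈ Finset.Icc 1 S.T, (∀ i, MemLp (fun ω => S.randomState x₁ w c r ω t i) 2 μΩ) →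
      ∀ i, MemLp (fun ω => S.randomAction x₁ w c r ω t i) 2 μΩ)
    {t : ℕ} (ht : t ∈ Finset.Icc 1 (S.T + 1)) (i : Fin n) :
    MemLp (fun ω => S.randomState x₁ w c r ω t i) 2 μΩ := by
  obtain ⟨h1, h2⟩ := Finset.mem_Icc.1 ht
  clear ht
  induction t, h1 using Nat.le_induction generalizing i with
  | base => exact h.memLp_init' i
  | succ t ht ih =>
    have hs := fun i => ih i (by omega)
    have e : (fun ω => S.randomState x₁ w c r ω (t + 1) i) = fun ω =>
        S.A t *ᵥ S.randomState x₁ w c r ω t i + S.B t *ᵥ S.randomAction x₁ w c r ω t i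
          + S.D t *ᵥ meanField (fun i => S.randomState x₁ w c r ω t i) + S.E t *ᵥ r ω
          + w t i ω :=
      funext fun ω => S.state_succ c (r ω) _ _ ht i
    rw [e]
    exact (((((hs i).matrix_mulVec (S.A t)).add
      ((hu t (Finset.mem_Icc.2 ⟨ht, by omega⟩) hs i).matrix_mulVec (S.B t))).add
      ((memLp_meanField hs).matrix_mulVec (S.D t))).add (hr.matrix_mulVec (S.E t))).add
      (h.memLp_noise' t i)

/-- The weight of the Riccati equation for the deviations. -/
noncomputable def Mbreve (t : ℕ) : Matrix (Fin dx) (Fin dx) ℝ :=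
  riccati S.T S.A S.B (fun t => S.Q t + S.P t + S.H t) S.R t

/-- The weight of the Riccati equation for (reference, mean-field). -/
noncomputable def Mbar (t : ℕ) : Matrix (Fin dx ⊕ Fin dx) (Fin dx ⊕ Fin dx) ℝ :=
  riccati S.T S.Abar S.Bbar S.Qbar S.R t

/-- The weight of the distance of an input deviation from its optimal feedback. -/
noncomputable def Gbreve (t : ℕ) : Matrix (Fin du) (Fin du) ℝ :=
  riccatiWeight S.T S.A S.B (fun t => S.Q t + S.P t + S.H t) S.R t

/-- The weight of the distance of the average input from its optimal feedback. -/
noncomputable def Gbar (t : ℕ) : Matrix (Fin du) (Fin du) ℝ :=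
  riccatiWeight S.T S.Abar S.Bbar S.Qbar S.R t

/-- The contribution of the initial states and of the noises to the optimal cost, for reference
`r`. -/
noncomputable def value (μΩ : Measure Ω) (x₁ : ℕ → Ω → Vec dx) (w : ℕ → ℕ → Ω → Vec dx) (n : ℕ)
    (r : Ω → Vec dx) : ℝ :=
  1 / (n : ℝ) * ∑ i : Fin n, ((∫ ω, qform (S.Mbreve 1) (x₁ i ω - initialMean x₁ n ω) ∂μΩ)
      + ∑ t ∈ Finset.Icc 1 S.T, ∫ ω, qform (S.Mbreve (t + 1))
          (w t i ω - meanField (fun j : Fin n => w t j ω)) ∂μΩ)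
    + ((∫ ω, qform (S.Mbar 1) (Sum.elim (r ω) (initialMean x₁ n ω)) ∂μΩ)
      + ∑ t ∈ Finset.Icc 1 S.T, ∫ ω, qform (S.Mbar (t + 1))
          (Sum.elim 0 (meanField (fun j : Fin n => w t j ω))) ∂μΩ)

/-- The excess over the optimal cost: the mean weighted squared distance of the inputs from the
optimal feedback. -/
noncomputable def gap (μΩ : Measure Ω) (x₁ : ℕ → Ω → Vec dx) (w : ℕ → ℕ → Ω → Vec dx)
    (c : Policy dx du n) (r : Ω → Vec dx) : ℝ :=
  1 / (n : ℝ) * ∑ i, ∑ t ∈ Finset.Icc 1 S.T, ∫ ω, qform (S.Gbreve t)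
      (S.randomAction x₁ w c r ω t i - meanField (S.randomAction x₁ w c r ω t)
        - S.Lbreve t *ᵥ (S.randomState x₁ w c r ω t i
          - meanField (S.randomState x₁ w c r ω t))) ∂μΩ
    + ∑ t ∈ Finset.Icc 1 S.T, ∫ ω, qform (S.Gbar t)
      (meanField (S.randomAction x₁ w c r ω t)
        - S.Lbar t *ᵥ Sum.elim (r ω) (meanField (S.randomState x₁ w c r ω t))) ∂μΩ

theorem gap_nonneg (hS : S.Admissible) (c : Policy dx du n) (r : Ω → Vec dx) :
    0 ≤ S.gap μΩ x₁ w c r := by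
  refine add_nonneg (mul_nonneg (by positivity) (Finset.sum_nonneg fun i _ =>
    Finset.sum_nonneg fun t ht => integral_nonneg fun ω => ?_))
    (Finset.sum_nonneg fun t ht => integral_nonneg fun ω => ?_)
  · exact (riccatiWeight_posSemidef hS.deviation_posSemidef hS.input_posDef ht).qform_nonneg _
  · exact (riccatiWeight_posSemidef hS.joint_posSemidef hS.input_posDef ht).qform_nonneg _

section ExpectedCost

variable {c : Policy dx du n} {r : Ω → Vec dx}

/-- The noises at time `t` are independent of the reference, the states and the inputs at time
`t`, which are determined by the past. -/
theorem indepFun_state_action_noise (h : PrimitiveVariables μΩ μx x₁ w)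
    (hc : ∀ t i, Measurable fun p : (Fin n → Vec dx) × Vec dx => c t i p.1 p.2)
    (hr : Measurable[initialSigma x₁] r) (t : ℕ) :
    IndepFun (fun ω => (r ω, S.randomState x₁ w c r ω t, S.randomAction x₁ w c r ω t))
      (fun ω => fun j : Fin n => w t j ω) μΩ := by
  have hx₁ := fun i => (measurable_init_initialSigma (x₁ := x₁) i).mono
    (initialSigma_le_pastSigma (w := w) t) le_rfl
  have hr' := hr.mono (initialSigma_le_pastSigma (w := w) t) le_rfl
  have hw : ∀ s < t, ∀ i, Measurable[pastSigma x₁ w t] (w s i) := fun s hs i =>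
    measurable_noise_pastSigma hs i
  have mx := @measurable_randomState dx du n S Ω x₁ w (pastSigma x₁ w t) c hc r hr' hx₁ t hw
  have mu := @measurable_randomAction dx du n S Ω x₁ w (pastSigma x₁ w t) c hc r hr' hx₁ t hw
  have mw : Measurable[noiseSigma x₁ w t] fun ω => fun j : Fin n => w t j ω :=
    @measurable_pi_lambda _ _ _ (noiseSigma x₁ w t) _ _ fun j =>
      measurable_noise_noiseSigma t j
  exact h.indepFun (hr'.prodMk (mx.prodMk mu)) mw

theorem integrable_deviationCost
    (hx : ∀ t ∈ Finset.Icc 1 (S.T + 1), ∀ i, MemLp (fun ω => S.randomState x₁ w c r ω t i) 2 μΩ)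
    (hu : ∀ t ∈ Finset.Icc 1 S.T, ∀ i, MemLp (fun ω => S.randomAction x₁ w c r ω t i) 2 μΩ)
    (i : Fin n) : Integrable (fun ω => S.deviationCost (S.randomState x₁ w c r ω)
      (S.randomAction x₁ w c r ω) i) μΩ := by
  refine integrable_finsetSum _ fun t ht => ?_
  have hx' := hx t (Finset.Icc_subset_Icc le_rfl (Nat.le_succ S.T) ht)
  exact (integrable_qform ((hx' i).sub (memLp_meanField hx')) _).add
    (integrable_qform ((hu t ht i).sub (memLp_meanField (hu t ht))) _)

theorem integrable_jointCost {ρ : Ω → Vec dx} (hρ : MemLp ρ 2 μΩ)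
    (hx : ∀ t ∈ Finset.Icc 1 (S.T + 1), ∀ i, MemLp (fun ω => S.randomState x₁ w c r ω t i) 2 μΩ)
    (hu : ∀ t ∈ Finset.Icc 1 S.T, ∀ i, MemLp (fun ω => S.randomAction x₁ w c r ω t i) 2 μΩ) :
    Integrable (fun ω => S.jointCost (ρ ω) (S.randomState x₁ w c r ω)
      (S.randomAction x₁ w c r ω)) μΩ := by
  refine integrable_finsetSum _ fun t ht => ?_
  have hx' := hx t (Finset.Icc_subset_Icc le_rfl (Nat.le_succ S.T) ht)
  exact (integrable_qform (memLp_sumElim hρ (memLp_meanField hx')) _).add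
    (integrable_qform (memLp_meanField (hu t ht)) _)

theorem integrable_cost (hS : S.Admissible) (hn : 1 ≤ n) {ρ : Ω → Vec dx} (hρ : MemLp ρ 2 μΩ)
    (hx : ∀ t ∈ Finset.Icc 1 (S.T + 1), ∀ i, MemLp (fun ω => S.randomState x₁ w c r ω t i) 2 μΩ)
    (hu : ∀ t ∈ Finset.Icc 1 S.T, ∀ i, MemLp (fun ω => S.randomAction x₁ w c r ω t i) 2 μΩ) :
    Integrable (fun ω => S.cost (ρ ω) (S.randomState x₁ w c r ω)
      (S.randomAction x₁ w c r ω)) μΩ := by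
  simp_rw [S.cost_eq hS hn]
  exact ((integrable_finsetSum _ fun i _ => S.integrable_deviationCost hx hu i).const_mul _).add
    (S.integrable_jointCost hρ hx hu)

theorem integral_deviationCost [IsProbabilityMeasure μΩ] (hS : S.Admissible) (hn : 1 ≤ n)
    (h : PrimitiveVariables μΩ μx x₁ w)
    (hc : ∀ t i, Measurable fun p : (Fin n → Vec dx) × Vec dx => c t i p.1 p.2)
    (hr : Measurable[initialSigma x₁] r)
    (hx : ∀ t ∈ Finset.Icc 1 (S.T + 1), ∀ i, MemLp (fun ω => S.randomState x₁ w c r ω t i) 2 μΩ)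
    (hu : ∀ t ∈ Finset.Icc 1 S.T, ∀ i, MemLp (fun ω => S.randomAction x₁ w c r ω t i) 2 μΩ)
    (i : Fin n) :
    ∫ ω, S.deviationCost (S.randomState x₁ w c r ω) (S.randomAction x₁ w c r ω) i ∂μΩ
      = (∫ ω, qform (S.Mbreve 1) (x₁ i ω - initialMean x₁ n ω) ∂μΩ)
        + ∑ t ∈ Finset.Icc 1 S.T, (∫ ω, qform (S.Mbreve (t + 1))
          (w t i ω - meanField (fun j : Fin n => w t j ω)) ∂μΩ)
        + ∑ t ∈ Finset.Icc 1 S.T, ∫ ω, qform (S.Gbreve t)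
          (S.randomAction x₁ w c r ω t i - meanField (S.randomAction x₁ w c r ω t)
            - S.Lbreve t *ᵥ (S.randomState x₁ w c r ω t i
              - meanField (S.randomState x₁ w c r ω t))) ∂μΩ := by
  have hwm : ∀ t, MemLp (fun ω => w t i ω - meanField (fun j : Fin n => w t j ω)) 2 μΩ :=
    fun t => (h.memLp_noise' t i).sub (memLp_meanField fun j => h.memLp_noise' t j)
  refine integral_lq hS.deviation_posSemidef hS.input_posDef
    (fun t ω => S.randomState x₁ w c r ω t i - meanField (S.randomState x₁ w c r ω t))
    (fun t ω => w t i ω - meanField (fun j : Fin n => w t j ω))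
    (fun t ω => S.randomAction x₁ w c r ω t i - meanField (S.randomAction x₁ w c r ω t))
    (fun t ht ω => S.deviation_state_succ hn c (r ω) _ _ (Finset.mem_Icc.1 ht).1 i)
    (fun t ht => (hx t ht i).sub (memLp_meanField (hx t ht)))
    (fun t ht => (hu t ht i).sub (memLp_meanField (hu t ht))) (fun t _ => hwm t)
    (fun t _ => ?_) (fun t _ => ?_)
  · rw [integral_sub ((h.memLp_noise' t i).integrable (by norm_num))
      ((memLp_meanField fun j : Fin n => h.memLp_noise' t j).integrable (by norm_num)),
      h.mean_noise', h.mean_meanField_noise, sub_zero]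
  · have hf : Measurable fun p : Vec dx × (Fin n → Vec dx) × (Fin n → Vec du) =>
        S.A t *ᵥ (p.2.1 i - meanField p.2.1) + S.B t *ᵥ (p.2.2 i - meanField p.2.2) := by
      have m1 : Measurable fun x : Fin n → Vec dx => S.A t *ᵥ (x i - meanField x) :=
        (measurable_matrix_mulVec (S.A t)).comp ((measurable_pi_apply i).sub measurable_meanField)
      have m2 : Measurable fun u : Fin n → Vec du => S.B t *ᵥ (u i - meanField u) :=
        (measurable_matrix_mulVec (S.B t)).comp ((measurable_pi_apply i).sub measurable_meanField)
      exact (m1.comp (measurable_fst.comp measurable_snd)).add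
        (m2.comp (measurable_snd.comp measurable_snd))
    have hg : Measurable fun p : Fin n → Vec dx => p i - meanField p :=
      (measurable_pi_apply i).sub measurable_meanField
    exact (S.indepFun_state_action_noise h hc hr t).comp hf hg

theorem integral_jointCost [IsProbabilityMeasure μΩ] (hS : S.Admissible) (hn : 1 ≤ n)
    (h : PrimitiveVariables μΩ μx x₁ w)
    (hc : ∀ t i, Measurable fun p : (Fin n → Vec dx) × Vec dx => c t i p.1 p.2)
    (hr : Measurable[initialSigma x₁] r) (hr2 : MemLp r 2 μΩ)
    (hx : ∀ t ∈ Finset.Icc 1 (S.T + 1), ∀ i, MemLp (fun ω => S.randomState x₁ w c r ω t i) 2 μΩ)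
    (hu : ∀ t ∈ Finset.Icc 1 S.T, ∀ i, MemLp (fun ω => S.randomAction x₁ w c r ω t i) 2 μΩ) :
    ∫ ω, S.jointCost (r ω) (S.randomState x₁ w c r ω) (S.randomAction x₁ w c r ω) ∂μΩ
      = (∫ ω, qform (S.Mbar 1) (Sum.elim (r ω) (initialMean x₁ n ω)) ∂μΩ)
        + ∑ t ∈ Finset.Icc 1 S.T, (∫ ω, qform (S.Mbar (t + 1))
          (Sum.elim 0 (meanField (fun j : Fin n => w t j ω))) ∂μΩ)
        + ∑ t ∈ Finset.Icc 1 S.T, ∫ ω, qform (S.Gbar t)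
          (meanField (S.randomAction x₁ w c r ω t)
            - S.Lbar t *ᵥ Sum.elim (r ω) (meanField (S.randomState x₁ w c r ω t))) ∂μΩ := by
  have hwm : ∀ t, MemLp (fun ω => meanField (fun j : Fin n => w t j ω)) 2 μΩ :=
    fun t => memLp_meanField fun j => h.memLp_noise' t j
  have hws : ∀ t, MemLp (fun ω => Sum.elim (0 : Vec dx)
      (meanField (fun j : Fin n => w t j ω))) 2 μΩ :=
    fun t => memLp_sumElim MemLp.zero (hwm t)
  refine integral_lq hS.joint_posSemidef hS.input_posDef
    (fun t ω => Sum.elim (r ω) (meanField (S.randomState x₁ w c r ω t)))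
    (fun t ω => Sum.elim 0 (meanField (fun j : Fin n => w t j ω)))
    (fun t ω => meanField (S.randomAction x₁ w c r ω t))
    (fun t ht ω => S.joint_state_succ hn c (r ω) _ _ (Finset.mem_Icc.1 ht).1)
    (fun t ht => memLp_sumElim hr2 (memLp_meanField (hx t ht)))
    (fun t ht => memLp_meanField (hu t ht)) (fun t _ => hws t)
    (fun t _ => ?_) (fun t _ => ?_)
  · funext a
    rw [eval_integral fun a => ((hws t).eval a).integrable (by norm_num)]
    cases a with
    | inl a => simp
    | inr a =>
      have := congr_fun (h.mean_meanField_noise t n) a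
      rw [eval_integral fun a => ((hwm t).eval a).integrable (by norm_num)] at this
      simpa using this
  · have hse : Measurable fun p : Vec dx × Vec dx => Sum.elim p.1 p.2 :=
      measurable_pi_lambda _ fun a => by
        cases a with
        | inl a => exact (measurable_pi_apply a).comp measurable_fst
        | inr a => exact (measurable_pi_apply a).comp measurable_snd
    have hf : Measurable fun p : Vec dx × (Fin n → Vec dx) × (Fin n → Vec du) =>
        S.Abar t *ᵥ Sum.elim p.1 (meanField p.2.1) + S.Bbar t *ᵥ meanField p.2.2 :=
      ((measurable_matrix_mulVec (S.Abar t)).comp (hse.comp (measurable_fst.prodMk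
        (measurable_meanField.comp (measurable_fst.comp measurable_snd))))).add
      ((measurable_matrix_mulVec (S.Bbar t)).comp
        (measurable_meanField.comp (measurable_snd.comp measurable_snd)))
    have hg : Measurable fun p : Fin n → Vec dx => Sum.elim (0 : Vec dx) (meanField p) :=
      hse.comp (measurable_const.prodMk measurable_meanField)
    exact (S.indepFun_state_action_noise h hc hr t).comp hf hg

/-- The expected cost of a square-integrable policy is the optimal value plus the gap. -/
theorem integral_cost [IsProbabilityMeasure μΩ] (hS : S.Admissible) (hn : 1 ≤ n)
    (h : PrimitiveVariables μΩ μx x₁ w)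
    (hc : ∀ t i, Measurable fun p : (Fin n → Vec dx) × Vec dx => c t i p.1 p.2)
    (hr : Measurable[initialSigma x₁] r) (hr2 : MemLp r 2 μΩ)
    (hx : ∀ t ∈ Finset.Icc 1 (S.T + 1), ∀ i, MemLp (fun ω => S.randomState x₁ w c r ω t i) 2 μΩ)
    (hu : ∀ t ∈ Finset.Icc 1 S.T, ∀ i, MemLp (fun ω => S.randomAction x₁ w c r ω t i) 2 μΩ) :
    ∫ ω, S.cost (r ω) (S.randomState x₁ w c r ω) (S.randomAction x₁ w c r ω) ∂μΩ
      = S.value μΩ x₁ w n r + S.gap μΩ x₁ w c r := by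
  simp_rw [S.cost_eq hS hn]
  rw [integral_add ((integrable_finsetSum _ fun i _ =>
      S.integrable_deviationCost hx hu i).const_mul _) (S.integrable_jointCost hr2 hx hu),
    integral_const_mul, integral_finsetSum _ fun i _ => S.integrable_deviationCost hx hu i,
    S.integral_jointCost hS hn h hc hr hr2 hx hu,
    Finset.sum_congr rfl fun i _ => S.integral_deviationCost hS hn h hc hr hx hu i,
    Finset.sum_add_distrib, mul_add, value, gap]
  ring

theorem expectedCost_eq_ofReal_integral (hS : S.Admissible) (hn : 1 ≤ n) {ρ : Ω → Vec dx}
    (hρ : MemLp ρ 2 μΩ)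
    (hx : ∀ t ∈ Finset.Icc 1 (S.T + 1), ∀ i, MemLp (fun ω => S.randomState x₁ w c r ω t i) 2 μΩ)
    (hu : ∀ t ∈ Finset.Icc 1 S.T, ∀ i, MemLp (fun ω => S.randomAction x₁ w c r ω t i) 2 μΩ) :
    S.expectedCost x₁ w μΩ ρ r c = ENNReal.ofReal
      (∫ ω, S.cost (ρ ω) (S.randomState x₁ w c r ω) (S.randomAction x₁ w c r ω) ∂μΩ) :=
  (ofReal_integral_eq_lintegral_ofReal (S.integrable_cost hS hn hρ hx hu)
    (ae_of_all _ fun _ => S.cost_nonneg hS hn _ _ _)).symm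

/-- A policy of finite cost has square-integrable inputs, since the input weights are positive
definite. -/
theorem memLp_randomAction_of_expectedCost_ne_top (hS : S.Admissible) (hn : 1 ≤ n)
    (h : PrimitiveVariables μΩ μx x₁ w)
    (hc : ∀ t i, Measurable fun p : (Fin n → Vec dx) × Vec dx => c t i p.1 p.2)
    (hr : Measurable r) {ρ : Ω → Vec dx} (hfin : S.expectedCost x₁ w μΩ ρ r c ≠ ⊤)
    {t : ℕ} (ht : t ∈ Finset.Icc 1 S.T) (i : Fin n) :
    MemLp (fun ω => S.randomAction x₁ w c r ω t i) 2 μΩ := by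
  obtain ⟨a, ha, hcoer⟩ := (hS.input_posDef t ht).exists_coercive
  have hmeas : Measurable fun ω => S.randomAction x₁ w c r ω t i :=
    (measurable_pi_apply i).comp (S.measurable_randomAction hc hr h.measurable_init t
      fun s _ j => h.measurable_noise s j)
  have hn0 : (0 : ℝ) < n := by exact_mod_cast hn
  have hbound : ∀ ω, a / n * ‖S.randomAction x₁ w c r ω t i‖ ^ 2
      ≤ S.cost (ρ ω) (S.randomState x₁ w c r ω) (S.randomAction x₁ w c r ω) := fun ω => by
    have hq : ∀ s ∈ Finset.Icc 1 S.T, ∀ j, 0 ≤ qform (S.R s) (S.randomAction x₁ w c r ω s j) :=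
      fun s hs j => (hS.input_posDef s hs).posSemidef.qform_nonneg _
    calc a / n * ‖S.randomAction x₁ w c r ω t i‖ ^ 2
        = 1 / n * (a * ‖S.randomAction x₁ w c r ω t i‖ ^ 2) := by ring
      _ ≤ 1 / n * ∑ j, qform (S.R t) (S.randomAction x₁ w c r ω t j) := by
        gcongr
        exact (hcoer _).trans (Finset.single_le_sum
          (f := fun j => qform (S.R t) (S.randomAction x₁ w c r ω t j))
          (fun j _ => hq t ht j) (Finset.mem_univ i))
      _ ≤ ∑ s ∈ Finset.Icc 1 S.T, 1 / (n : ℝ) *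
            ∑ j, qform (S.R s) (S.randomAction x₁ w c r ω s j) :=
        Finset.single_le_sum (f := fun s => 1 / (n : ℝ) *
            ∑ j, qform (S.R s) (S.randomAction x₁ w c r ω s j))
          (fun s hs => mul_nonneg (by positivity) (Finset.sum_nonneg fun j _ => hq s hs j)) ht
      _ ≤ _ := S.sum_qform_input_le_cost hS hn _ _ _
  -- domination bounds the second moment without measurability of the cost
  have hint : Integrable (fun ω => a / n * ‖S.randomAction x₁ w c r ω t i‖ ^ 2) μΩ := by
    refine ⟨((hmeas.norm.pow_const 2).const_mul _).aestronglyMeasurable, ?_⟩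
    rw [hasFiniteIntegral_iff_ofReal (ae_of_all _ fun ω => by positivity)]
    exact (lintegral_mono fun ω => ENNReal.ofReal_le_ofReal (hbound ω)).trans_lt hfin.lt_top
  rw [memLp_two_iff_integrable_sq_norm hmeas.aestronglyMeasurable]
  have := hint.const_mul (a / n)⁻¹
  have hne : a / n ≠ 0 := by positivity
  simpa only [inv_mul_cancel_left₀ hne] using this

end ExpectedCost

end Network

/-! ### Feedback on the own state, the reference and a substitute for the mean-field -/

namespace Network

variable {dx du n : ℕ} (S : Network dx du)

/-- The optimal linear feedback with the mean-field replaced by `ζ t x r`. The proposed strategy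
and the mean-field strategy are the cases `ζ = z` and `ζ = x̄`. -/
noncomputable def feedbackPolicy (ζ : ℕ → (Fin n → Vec dx) → Vec dx → Vec dx) :
    Policy dx du n := fun t i x r =>
  S.Lbreve t *ᵥ x i + S.Lref t *ᵥ r + (S.Lmean t - S.Lbreve t) *ᵥ ζ t x r

theorem proposed_eq_feedbackPolicy (μ : Vec dx) (n : ℕ) :
    S.proposed μ n = S.feedbackPolicy (n := n) fun t _ r => S.approxMean μ r t := rfl

theorem meanFieldPolicy_eq_feedbackPolicy (n : ℕ) :
    S.meanFieldPolicy n = S.feedbackPolicy (n := n) fun _ x _ => meanField x := rfl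

section Feedback

variable (ζ : ℕ → (Fin n → Vec dx) → Vec dx → Vec dx) (r : Vec dx) (x₁ : Fin n → Vec dx)
  (w : ℕ → Fin n → Vec dx)

theorem measurable_feedbackPolicy
    (hζ : ∀ t, Measurable fun p : (Fin n → Vec dx) × Vec dx => ζ t p.1 p.2) (t : ℕ) (i : Fin n) :
    Measurable fun p : (Fin n → Vec dx) × Vec dx => S.feedbackPolicy ζ t i p.1 p.2 :=
  (((measurable_matrix_mulVec (S.Lbreve t)).comp ((measurable_pi_apply i).comp measurable_fst)).add
    ((measurable_matrix_mulVec (S.Lref t)).comp measurable_snd)).add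
    ((measurable_matrix_mulVec (S.Lmean t - S.Lbreve t)).comp (hζ t))

theorem meanField_action_feedback (hn : 1 ≤ n) (t : ℕ) :
    meanField (S.action (S.feedbackPolicy ζ) r x₁ w t)
      = S.Lbreve t *ᵥ meanField (S.state (S.feedbackPolicy ζ) r x₁ w t) + S.Lref t *ᵥ r
        + (S.Lmean t - S.Lbreve t) *ᵥ ζ t (S.state (S.feedbackPolicy ζ) r x₁ w t) r := by
  have e : S.action (S.feedbackPolicy ζ) r x₁ w t = fun i =>
      S.Lbreve t *ᵥ S.state (S.feedbackPolicy ζ) r x₁ w t i + S.Lref t *ᵥ r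
        + (S.Lmean t - S.Lbreve t) *ᵥ ζ t (S.state (S.feedbackPolicy ζ) r x₁ w t) r := rfl
  rw [e, meanField_add, meanField_add, meanField_mulVec, meanField_const hn, meanField_const hn]

theorem deviation_action_feedback (hn : 1 ≤ n) (t : ℕ) (i : Fin n) :
    S.action (S.feedbackPolicy ζ) r x₁ w t i - meanField (S.action (S.feedbackPolicy ζ) r x₁ w t)
      = S.Lbreve t *ᵥ (S.state (S.feedbackPolicy ζ) r x₁ w t i
        - meanField (S.state (S.feedbackPolicy ζ) r x₁ w t)) := by
  rw [S.meanField_action_feedback ζ r x₁ w hn, action, feedbackPolicy, mulVec_sub]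
  abel

theorem meanField_action_sub_Lbar (hn : 1 ≤ n) (t : ℕ) :
    meanField (S.action (S.feedbackPolicy ζ) r x₁ w t)
        - S.Lbar t *ᵥ Sum.elim r (meanField (S.state (S.feedbackPolicy ζ) r x₁ w t))
      = (S.Lbreve t - S.Lmean t) *ᵥ (meanField (S.state (S.feedbackPolicy ζ) r x₁ w t)
        - ζ t (S.state (S.feedbackPolicy ζ) r x₁ w t) r) := by
  rw [S.meanField_action_feedback ζ r x₁ w hn, Lbar_mulVec]
  simp only [mulVec_sub, sub_mulVec]
  abel

theorem meanField_feedback_succ (hn : 1 ≤ n) {t : ℕ} (ht : 1 ≤ t) :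
    meanField (S.state (S.feedbackPolicy ζ) r x₁ w (t + 1))
      = (S.A t + S.B t * S.Lbreve t + S.D t) *ᵥ
          meanField (S.state (S.feedbackPolicy ζ) r x₁ w t)
        + (S.B t * (S.Lmean t - S.Lbreve t)) *ᵥ
          ζ t (S.state (S.feedbackPolicy ζ) r x₁ w t) r
        + (S.B t * S.Lref t + S.E t) *ᵥ r + meanField (w t) := by
  rw [S.meanField_state_succ hn _ _ _ _ ht, S.meanField_action_feedback ζ r x₁ w hn]
  simp only [add_mulVec, mulVec_add, mulVec_mulVec]
  abel

theorem approxMean_succ (μ r : Vec dx) {t : ℕ} (ht : 1 ≤ t) :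
    S.approxMean μ r (t + 1)
      = (S.A t + S.B t * S.Lmean t + S.D t) *ᵥ S.approxMean μ r t
        + (S.B t * S.Lref t + S.E t) *ᵥ r := by
  obtain ⟨t, rfl⟩ := Nat.exists_eq_add_of_le' ht
  rfl

/-- The error of the mean-field approximation evolves independently of the reference. -/
theorem meanField_proposed_sub_approxMean_succ (hn : 1 ≤ n) (μ : Vec dx) {t : ℕ} (ht : 1 ≤ t) :
    meanField (S.state (S.proposed μ n) r x₁ w (t + 1)) - S.approxMean μ r (t + 1)
      = (S.A t + S.B t * S.Lbreve t + S.D t) *ᵥ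
          (meanField (S.state (S.proposed μ n) r x₁ w t) - S.approxMean μ r t)
        + meanField (w t) := by
  rw [proposed_eq_feedbackPolicy, S.meanField_feedback_succ _ r x₁ w hn ht,
    S.approxMean_succ μ r ht]
  simp only [add_mulVec, mulVec_sub, Matrix.mul_sub, sub_mulVec]
  abel

theorem meanField_optimal_sub_approxMean_succ (hn : 1 ≤ n) (μ r' : Vec dx) {t : ℕ}
    (ht : 1 ≤ t) :
    meanField (S.state (S.meanFieldPolicy n) r x₁ w (t + 1)) - S.approxMean μ r' (t + 1)
      = (S.A t + S.B t * S.Lmean t + S.D t) *ᵥ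
          (meanField (S.state (S.meanFieldPolicy n) r x₁ w t) - S.approxMean μ r' t)
        + (S.B t * S.Lref t + S.E t) *ᵥ (r - r') + meanField (w t) := by
  rw [meanFieldPolicy_eq_feedbackPolicy, S.meanField_feedback_succ _ r x₁ w hn ht,
    S.approxMean_succ μ r' ht]
  simp only [add_mulVec, mulVec_sub, Matrix.mul_sub, sub_mulVec]
  abel

/-- The deviations from the mean-field depend neither on the substitute for the mean-field nor on
the reference. -/
theorem deviation_feedback_eq (hn : 1 ≤ n) (ζ' : ℕ → (Fin n → Vec dx) → Vec dx → Vec dx)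
    (r' : Vec dx) {t : ℕ} (ht : 1 ≤ t) (i : Fin n) :
    S.state (S.feedbackPolicy ζ) r x₁ w t i - meanField (S.state (S.feedbackPolicy ζ) r x₁ w t)
      = S.state (S.feedbackPolicy ζ') r' x₁ w t i
        - meanField (S.state (S.feedbackPolicy ζ') r' x₁ w t) := by
  induction t, ht using Nat.le_induction with
  | base => rfl
  | succ t ht ih =>
    rw [S.deviation_state_succ hn _ _ _ _ ht, S.deviation_state_succ hn _ _ _ _ ht,
      S.deviation_action_feedback ζ r x₁ w hn, S.deviation_action_feedback ζ' r' x₁ w hn, ih]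

/-- Two feedbacks move all followers apart by the same vector. -/
theorem norm_state_feedback_sub_le (hn : 1 ≤ n) (ζ' : ℕ → (Fin n → Vec dx) → Vec dx → Vec dx)
    (r' : Vec dx) {t : ℕ} (ht : 1 ≤ t) :
    ‖S.state (S.feedbackPolicy ζ) r x₁ w t - S.state (S.feedbackPolicy ζ') r' x₁ w t‖
      ≤ ‖meanField (S.state (S.feedbackPolicy ζ) r x₁ w t)
        - meanField (S.state (S.feedbackPolicy ζ') r' x₁ w t)‖ := by
  refine (pi_norm_le_iff_of_nonneg (norm_nonneg _)).2 fun i => le_of_eq ?_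
  have h := S.deviation_feedback_eq ζ r x₁ w hn ζ' r' ht i
  rw [Pi.sub_apply]
  congr 1
  rw [sub_eq_sub_iff_add_eq_add] at h ⊢
  rw [h, add_comm]

end Feedback

variable {Ω : Type*} [MeasurableSpace Ω] {μΩ : Measure Ω}
  {μx : Vec dx} {x₁ : ℕ → Ω → Vec dx} {w : ℕ → ℕ → Ω → Vec dx}

theorem memLp_approxMean [IsProbabilityMeasure μΩ] (μ : Vec dx) {r : Ω → Vec dx}
    (hr : MemLp r 2 μΩ) (t : ℕ) : MemLp (fun ω => S.approxMean μ (r ω) t) 2 μΩ := by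
  induction t with
  | zero => exact memLp_const μ
  | succ t ih =>
    rcases Nat.eq_zero_or_pos t with rfl | ht
    · exact memLp_const μ
    have e : (fun ω => S.approxMean μ (r ω) (t + 1)) = fun ω =>
        (S.A t + S.B t * S.Lmean t + S.D t) *ᵥ S.approxMean μ (r ω) t
          + (S.B t * S.Lref t + S.E t) *ᵥ r ω := funext fun ω => S.approxMean_succ μ (r ω) ht
    rw [e]
    exact (ih.matrix_mulVec (S.A t + S.B t * S.Lmean t + S.D t)).add
      (hr.matrix_mulVec (S.B t * S.Lref t + S.E t))

theorem measurable_approxMean (μ : Vec dx) (t : ℕ) : Measurable fun r => S.approxMean μ r t := by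
  induction t with
  | zero => exact measurable_const
  | succ t ih =>
    rcases Nat.eq_zero_or_pos t with rfl | ht
    · exact measurable_const
    have e : (fun r => S.approxMean μ r (t + 1)) = fun r =>
        (S.A t + S.B t * S.Lmean t + S.D t) *ᵥ S.approxMean μ r t
          + (S.B t * S.Lref t + S.E t) *ᵥ r := funext fun r => S.approxMean_succ μ r ht
    rw [e]
    exact ((measurable_matrix_mulVec (S.A t + S.B t * S.Lmean t + S.D t)).comp ih).add
      (measurable_matrix_mulVec (S.B t * S.Lref t + S.E t))

theorem measurable_proposed (μ : Vec dx) (t : ℕ) (i : Fin n) :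
    Measurable fun p : (Fin n → Vec dx) × Vec dx => S.proposed μ n t i p.1 p.2 :=
  S.measurable_feedbackPolicy (fun t _ r => S.approxMean μ r t)
    (fun t => (S.measurable_approxMean μ t).comp measurable_snd) t i

theorem measurable_meanFieldPolicy (t : ℕ) (i : Fin n) :
    Measurable fun p : (Fin n → Vec dx) × Vec dx => S.meanFieldPolicy n t i p.1 p.2 :=
  S.measurable_feedbackPolicy (fun _ x _ => meanField x)
    (fun _ => measurable_meanField.comp measurable_fst) t i

theorem memLp_action_feedback {ζ : ℕ → (Fin n → Vec dx) → Vec dx → Vec dx} {r : Ω → Vec dx}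
    (hr : MemLp r 2 μΩ) {t : ℕ}
    (hζ : MemLp (fun ω => ζ t (S.randomState x₁ w (S.feedbackPolicy ζ) r ω t) (r ω)) 2 μΩ)
    {i : Fin n}
    (hx : MemLp (fun ω => S.randomState x₁ w (S.feedbackPolicy ζ) r ω t i) 2 μΩ) :
    MemLp (fun ω => S.randomAction x₁ w (S.feedbackPolicy ζ) r ω t i) 2 μΩ :=
  ((hx.matrix_mulVec (S.Lbreve t)).add (hr.matrix_mulVec (S.Lref t))).add
    (hζ.matrix_mulVec (S.Lmean t - S.Lbreve t))

theorem memLp_proposed [IsProbabilityMeasure μΩ] (h : PrimitiveVariables μΩ μx x₁ w)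
    {r : Ω → Vec dx} (hr : MemLp r 2 μΩ) (n : ℕ) :
    (∀ t ∈ Finset.Icc 1 (S.T + 1), ∀ i,
      MemLp (fun ω => S.randomState x₁ w (S.proposed μx n) r ω t i) 2 μΩ) ∧
    ∀ t ∈ Finset.Icc 1 S.T, ∀ i,
      MemLp (fun ω => S.randomAction x₁ w (S.proposed μx n) r ω t i) 2 μΩ := by
  have hx : ∀ t ∈ Finset.Icc 1 (S.T + 1), ∀ i,
      MemLp (fun ω => S.randomState x₁ w (S.proposed μx n) r ω t i) 2 μΩ := fun t ht i =>
    S.memLp_randomState h hr (fun t _ hx i =>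
      S.memLp_action_feedback hr (S.memLp_approxMean μx hr t) (hx i)) ht i
  exact ⟨hx, fun t ht i => S.memLp_action_feedback hr (S.memLp_approxMean μx hr t)
    (hx t (Finset.Icc_subset_Icc le_rfl (Nat.le_succ S.T) ht) i)⟩

theorem memLp_meanFieldPolicy (h : PrimitiveVariables μΩ μx x₁ w)
    {r : Ω → Vec dx} (hr : MemLp r 2 μΩ) (n : ℕ) :
    (∀ t ∈ Finset.Icc 1 (S.T + 1), ∀ i,
      MemLp (fun ω => S.randomState x₁ w (S.meanFieldPolicy n) r ω t i) 2 μΩ) ∧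
    ∀ t ∈ Finset.Icc 1 S.T, ∀ i,
      MemLp (fun ω => S.randomAction x₁ w (S.meanFieldPolicy n) r ω t i) 2 μΩ := by
  have hx : ∀ t ∈ Finset.Icc 1 (S.T + 1), ∀ i,
      MemLp (fun ω => S.randomState x₁ w (S.meanFieldPolicy n) r ω t i) 2 μΩ := fun t ht i =>
    S.memLp_randomState h hr (fun t _ hx i =>
      S.memLp_action_feedback hr (memLp_meanField hx) (hx i)) ht i
  exact ⟨hx, fun t ht i => S.memLp_action_feedback hr
    (memLp_meanField (hx t (Finset.Icc_subset_Icc le_rfl (Nat.le_succ S.T) ht)))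
    (hx t (Finset.Icc_subset_Icc le_rfl (Nat.le_succ S.T) ht) i)⟩

/-- Under a feedback the inputs are suboptimal only through the error of the substitute for the
mean-field. -/
theorem gap_feedback (hn : 1 ≤ n) (ζ : ℕ → (Fin n → Vec dx) → Vec dx → Vec dx)
    (r : Ω → Vec dx) :
    S.gap μΩ x₁ w (S.feedbackPolicy ζ) r
      = ∑ t ∈ Finset.Icc 1 S.T, ∫ ω, qform (S.Gbar t) ((S.Lbreve t - S.Lmean t) *ᵥ
        (meanField (S.randomState x₁ w (S.feedbackPolicy ζ) r ω t)
          - ζ t (S.randomState x₁ w (S.feedbackPolicy ζ) r ω t) (r ω))) ∂μΩ := by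
  simp only [gap, randomAction, randomState, S.meanField_action_sub_Lbar ζ _ _ _ hn,
    S.deviation_action_feedback ζ _ _ _ hn, sub_self, qform_zero, integral_zero,
    Finset.sum_const_zero, mul_zero, zero_add]

theorem gap_meanFieldPolicy (hn : 1 ≤ n) (r : Ω → Vec dx) :
    S.gap μΩ x₁ w (S.meanFieldPolicy n) r = 0 := by
  rw [meanFieldPolicy_eq_feedbackPolicy, S.gap_feedback hn]
  simp

section OptimalCost

variable [IsProbabilityMeasure μΩ] {r : Ω → Vec dx}

theorem expectedCost_meanFieldPolicy (hS : S.Admissible) (hn : 1 ≤ n)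
    (h : PrimitiveVariables μΩ μx x₁ w) (hr : Measurable[initialSigma x₁] r)
    (hr2 : MemLp r 2 μΩ) :
    S.expectedCost x₁ w μΩ r r (S.meanFieldPolicy n)
      = ENNReal.ofReal (S.value μΩ x₁ w n r) := by
  obtain ⟨hx, hu⟩ := S.memLp_meanFieldPolicy h hr2 n
  rw [S.expectedCost_eq_ofReal_integral hS hn hr2 hx hu,
    S.integral_cost hS hn h S.measurable_meanFieldPolicy hr hr2 hx hu, S.gap_meanFieldPolicy hn,
    add_zero]

theorem expectedCost_proposed (hS : S.Admissible) (hn : 1 ≤ n)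
    (h : PrimitiveVariables μΩ μx x₁ w) (hr : Measurable[initialSigma x₁] r)
    (hr2 : MemLp r 2 μΩ) :
    S.expectedCost x₁ w μΩ r r (S.proposed μx n)
      = ENNReal.ofReal (S.value μΩ x₁ w n r + S.gap μΩ x₁ w (S.proposed μx n) r) := by
  obtain ⟨hx, hu⟩ := S.memLp_proposed h hr2 n
  rw [S.expectedCost_eq_ofReal_integral hS hn hr2 hx hu,
    S.integral_cost hS hn h (S.measurable_proposed μx) hr hr2 hx hu]

/-- The optimal cost over all measurable policies, for a reference determined by the initial
states. -/
theorem optimalCost_eq (hS : S.Admissible) (hn : 1 ≤ n)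
    (h : PrimitiveVariables μΩ μx x₁ w) (hr : Measurable[initialSigma x₁] r)
    (hr2 : MemLp r 2 μΩ) :
    S.optimalCost x₁ w μΩ n r = ENNReal.ofReal (S.value μΩ x₁ w n r) := by
  refine le_antisymm ?_ (le_iInf₂ fun c hc => ?_)
  · exact (iInf₂_le (S.meanFieldPolicy n) S.measurable_meanFieldPolicy).trans_eq
      (S.expectedCost_meanFieldPolicy hS hn h hr hr2)
  -- a policy of infinite cost needs no argument; the others are square-integrable
  · by_cases hfin : S.expectedCost x₁ w μΩ r r c = ⊤
    · rw [hfin]; exact le_top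
    have hu : ∀ t ∈ Finset.Icc 1 S.T, ∀ i,
        MemLp (fun ω => S.randomAction x₁ w c r ω t i) 2 μΩ := fun t ht i =>
      S.memLp_randomAction_of_expectedCost_ne_top hS hn h hc
        (hr.mono h.initialSigma_le le_rfl) hfin ht i
    have hx : ∀ t ∈ Finset.Icc 1 (S.T + 1), ∀ i,
        MemLp (fun ω => S.randomState x₁ w c r ω t i) 2 μΩ := fun t ht i =>
      S.memLp_randomState h hr2 (fun t ht _ => hu t ht) ht i
    rw [S.expectedCost_eq_ofReal_integral hS hn hr2 hx hu,
      S.integral_cost hS hn h hc hr hr2 hx hu]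
    exact ENNReal.ofReal_le_ofReal (le_add_of_nonneg_right (S.gap_nonneg hS c r))

end OptimalCost

end Network

/-! ### Errors of order `1/n` -/

/-- The sequence is `O(1/n)`, with a constant valid for all `n ≥ 1`. -/
def InvRate (f : ℕ → ℝ) : Prop := ∃ C : ℝ, ∀ n : ℕ, 1 ≤ n → |f n| ≤ C / n

namespace InvRate

variable {f g : ℕ → ℝ}

theorem congr (hf : InvRate f) (h : ∀ n, 1 ≤ n → g n = f n) : InvRate g := by
  obtain ⟨C, hC⟩ := hf
  exact ⟨C, fun n hn => h n hn ▸ hC n hn⟩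

theorem add (hf : InvRate f) (hg : InvRate g) : InvRate (fun n => f n + g n) := by
  obtain ⟨C, hC⟩ := hf
  obtain ⟨D, hD⟩ := hg
  refine ⟨C + D, fun n hn => (abs_add_le _ _).trans ?_⟩
  rw [add_div]
  exact add_le_add (hC n hn) (hD n hn)

theorem const_mul (hf : InvRate f) (a : ℝ) : InvRate (fun n => a * f n) := by
  obtain ⟨C, hC⟩ := hf
  refine ⟨|a| * C, fun n hn => ?_⟩
  rw [abs_mul, mul_div_assoc]
  exact mul_le_mul_of_nonneg_left (hC n hn) (abs_nonneg a)

theorem sub (hf : InvRate f) (hg : InvRate g) : InvRate (fun n => f n - g n) :=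
  (hf.add (hg.const_mul (-1))).congr fun n _ => by ring

theorem sum {ι : Type*} (s : Finset ι) {f : ι → ℕ → ℝ} (hf : ∀ i ∈ s, InvRate (f i)) :
    InvRate (fun n => ∑ i ∈ s, f i n) := by
  classical
  induction s using Finset.induction_on with
  | empty => exact ⟨0, fun n _ => by simp⟩
  | insert a s ha ih =>
    refine ((hf a (Finset.mem_insert_self a s)).add
      (ih fun i hi => hf i (Finset.mem_insert_of_mem hi))).congr fun n _ => ?_
    rw [Finset.sum_insert ha]

end InvRate

section CenteredRate

variable {m k : Type} [Fintype m] [Fintype k] {Ω : Type*} [MeasurableSpace Ω] {μ : Measure Ω}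

/-- A bilinear expression has mean `O(1/n)` when one factor is centered with mean-square rate
`O(1/n)` and the other one is a constant plus a term of mean-square rate `O(1/n)`. -/
theorem SqMeanRate.integral_bilin_add_const [IsFiniteMeasure μ] {X : ℕ → Ω → m → ℝ}
    {Y : ℕ → Ω → k → ℝ} (hX : SqMeanRate μ X) (hY : SqMeanRate μ Y)
    (hY0 : ∀ n, 1 ≤ n → ∫ ω, Y n ω ∂μ = 0) (N : Matrix m k ℝ) (a : m → ℝ) :
    InvRate (fun n => ∫ ω, (a + X n ω) ⬝ᵥ (N *ᵥ Y n ω) ∂μ) := by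
  obtain ⟨C, hC⟩ := hX.integral_bilin hY N
  refine InvRate.congr ⟨C, hC⟩ fun n hn => ?_
  have hNY := (hY.1 n hn).matrix_mulVec N
  simp only [add_dotProduct]
  rw [integral_add (integrable_dotProduct (memLp_const a) hNY)
      (integrable_dotProduct (hX.1 n hn) hNY),
    integral_const_dotProduct (hNY.integrable (by norm_num)),
    integral_matrix_mulVec ((hY.1 n hn).integrable (by norm_num)), hY0 n hn]
  simp

end CenteredRate

namespace Network

variable {dx du : ℕ} (S : Network dx du) {Ω : Type*} [MeasurableSpace Ω] {μΩ : Measure Ω}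
  {μx : Vec dx} {x₁ : ℕ → Ω → Vec dx} {w : ℕ → ℕ → Ω → Vec dx}

section MeanSquare

variable [IsProbabilityMeasure μΩ]

theorem sqMeanRate_initialMean (h : PrimitiveVariables μΩ μx x₁ w) :
    SqMeanRate μΩ (fun n ω => initialMean x₁ n ω - μx) :=
  sqMeanRate_meanField h.pairwise_indep_init h.identDistrib_init h.memLp_init h.mean_init

theorem integral_initialMean_sub (h : PrimitiveVariables μΩ μx x₁ w) {n : ℕ} (hn : 1 ≤ n) :
    ∫ ω, (initialMean x₁ n ω - μx) ∂μΩ = 0 := by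
  rw [integral_sub ((h.memLp_initialMean n).integrable (by norm_num)) (integrable_const μx),
    h.mean_initialMean hn]
  simp

/-- The constant in the `O(1/n)` error of the mean-field approximation is uniform because the error
recursion does not involve the reference. -/
theorem sqMeanRate_approxMean (h : PrimitiveVariables μΩ μx x₁ w) (r : ℕ → Ω → Vec dx) {t : ℕ}
    (ht : 1 ≤ t) :
    SqMeanRate μΩ (fun n ω => meanField (S.randomState x₁ w (S.proposed μx n) (r n) ω t)
      - S.approxMean μx (r n ω) t) := by
  induction t, ht using Nat.le_induction with
  | base => exact sqMeanRate_initialMean h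
  | succ t ht ih =>
    have hw : SqMeanRate μΩ (fun n ω => meanField (fun j : Fin n => w t j ω)) := by
      simpa using sqMeanRate_meanField (h.pairwise_indep_noise t) (h.identDistrib_noise t)
        (h.memLp_noise t) (h.mean_noise t)
    exact ((ih.mulVec (S.A t + S.B t * S.Lbreve t + S.D t)).add hw).congr fun n hn ω =>
      S.meanField_proposed_sub_approxMean_succ _ _ _ hn μx ht

theorem invRate_gap_proposed (h : PrimitiveVariables μΩ μx x₁ w) (r : ℕ → Ω → Vec dx) :
    InvRate (fun n => S.gap μΩ x₁ w (S.proposed μx n) (r n)) := by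
  refine (InvRate.sum (Finset.Icc 1 S.T) (f := fun t n =>
    ∫ ω, qform (S.Gbar t) ((S.Lbreve t - S.Lmean t) *ᵥ
      (meanField (S.randomState x₁ w (S.proposed μx n) (r n) ω t)
        - S.approxMean μx (r n ω) t)) ∂μΩ) fun t ht => ?_).congr
    fun n hn => S.gap_feedback hn _ _
  have hr := (S.sqMeanRate_approxMean h r (Finset.mem_Icc.1 ht).1).mulVec
    (S.Lbreve t - S.Lmean t)
  exact hr.integral_bilin hr (S.Gbar t)

/-- Replacing the reference `μx` by the initial mean changes the optimal cost by `O(1/n)`: the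
first-order term is centered. -/
theorem invRate_value_sub (hS : S.Admissible) (h : PrimitiveVariables μΩ μx x₁ w) :
    InvRate (fun n => S.value μΩ x₁ w n (initialMean x₁ n)
      - S.value μΩ x₁ w n (fun _ => μx)) := by
  have hM : (S.Mbar 1).IsSymm :=
    (riccati_posSemidef hS.joint_posSemidef hS.input_posDef le_rfl).isSymm
  have hδ := sqMeanRate_initialMean h
  have e1 : ∀ v : Vec dx, (fromRows 1 0 : Matrix (Fin dx ⊕ Fin dx) (Fin dx) ℝ) *ᵥ v
      = Sum.elim v 0 := fun v => by rw [fromRows_mulVec, one_mulVec, zero_mulVec]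
  have e2 : ∀ v : Vec dx, (fromRows 0 1 : Matrix (Fin dx ⊕ Fin dx) (Fin dx) ℝ) *ᵥ v
      = Sum.elim (0 : Vec dx) v := fun v => by rw [fromRows_mulVec, one_mulVec, zero_mulVec]
  have h1 : SqMeanRate μΩ (fun n ω => Sum.elim (initialMean x₁ n ω - μx) (0 : Vec dx)) :=
    (hδ.mulVec (fromRows 1 0)).congr fun n _ ω => (e1 _).symm
  have h2 : SqMeanRate μΩ (fun n ω => Sum.elim (0 : Vec dx) (initialMean x₁ n ω - μx)) :=
    (hδ.mulVec (fromRows 0 1)).congr fun n _ ω => (e2 _).symm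
  have h0 : ∀ n, 1 ≤ n →
      ∫ ω, Sum.elim (initialMean x₁ n ω - μx) (0 : Vec dx) ∂μΩ = 0 := fun n hn => by
    simp_rw [← e1]
    rw [integral_matrix_mulVec ((hδ.1 n hn).integrable (by norm_num)),
      integral_initialMean_sub h hn, mulVec_zero]
  have r1 : InvRate fun n => ∫ ω, qform (S.Mbar 1)
      (Sum.elim (initialMean x₁ n ω - μx) (0 : Vec dx)) ∂μΩ := h1.integral_bilin h1 (S.Mbar 1)
  have r2 := (h2.integral_bilin_add_const h1 h0 (S.Mbar 1) (Sum.elim μx μx)).const_mul 2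
  refine (r1.add r2).congr fun n hn => ?_
  have hc : MemLp (fun _ : Ω => Sum.elim μx μx) 2 μΩ := memLp_const _
  have eq : ∀ ω, qform (S.Mbar 1) (Sum.elim (initialMean x₁ n ω) (initialMean x₁ n ω))
      = qform (S.Mbar 1) (Sum.elim μx (initialMean x₁ n ω))
        + (qform (S.Mbar 1) (Sum.elim (initialMean x₁ n ω - μx) (0 : Vec dx))
        + 2 * ((Sum.elim μx μx + Sum.elim (0 : Vec dx) (initialMean x₁ n ω - μx)) ⬝ᵥ
          (S.Mbar 1 *ᵥ Sum.elim (initialMean x₁ n ω - μx) (0 : Vec dx)))) := fun ω => by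
    have s1 : Sum.elim μx μx + Sum.elim (0 : Vec dx) (initialMean x₁ n ω - μx)
        = Sum.elim μx (initialMean x₁ n ω) := by
      funext a; cases a <;> simp
    have s2 : Sum.elim (initialMean x₁ n ω) (initialMean x₁ n ω)
        = Sum.elim μx (initialMean x₁ n ω) + Sum.elim (initialMean x₁ n ω - μx) (0 : Vec dx) := by
      funext a; cases a <;> simp
    rw [s1, s2, qform_add hM, add_assoc]
  have i1 := integrable_qform (h1.1 n hn) (S.Mbar 1)
  have i2 := (integrable_bilin (hc.add (h2.1 n hn)) (h1.1 n hn) (S.Mbar 1)).const_mul 2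
  have i3 := integrable_qform
    (memLp_sumElim (memLp_const (μ := μΩ) (p := 2) μx) (h.memLp_initialMean n)) (S.Mbar 1)
  have key : ∫ ω, qform (S.Mbar 1) (Sum.elim (initialMean x₁ n ω) (initialMean x₁ n ω)) ∂μΩ
      = (∫ ω, qform (S.Mbar 1) (Sum.elim μx (initialMean x₁ n ω)) ∂μΩ)
        + ((∫ ω, qform (S.Mbar 1) (Sum.elim (initialMean x₁ n ω - μx) (0 : Vec dx)) ∂μΩ)
        + 2 * ∫ ω, (Sum.elim μx μx + Sum.elim (0 : Vec dx) (initialMean x₁ n ω - μx)) ⬝ᵥ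
          (S.Mbar 1 *ᵥ Sum.elim (initialMean x₁ n ω - μx) (0 : Vec dx)) ∂μΩ) := by
    rw [integral_congr_ae (ae_of_all _ eq)]
    refine (integral_add i3 (i1.add i2)).trans ?_
    congr 1
    refine (integral_add i1 i2).trans ?_
    rw [integral_const_mul]
    rfl
  simp only [value, key]
  ring

/-- Changing the target from `μx` to the initial mean changes the cost of the proposed strategy
with reference `μx` by `O(1/n)`: up to errors of mean-square order `1/n`, the mean-field is
deterministic. -/
theorem invRate_cost_target_sub (hS : S.Admissible) (h : PrimitiveVariables μΩ μx x₁ w) :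
    InvRate (fun n =>
      (∫ ω, S.cost (initialMean x₁ n ω) (S.randomState x₁ w (S.proposed μx n) (fun _ => μx) ω)
        (S.randomAction x₁ w (S.proposed μx n) (fun _ => μx) ω) ∂μΩ)
      - ∫ ω, S.cost μx (S.randomState x₁ w (S.proposed μx n) (fun _ => μx) ω)
        (S.randomAction x₁ w (S.proposed μx n) (fun _ => μx) ω) ∂μΩ) := by
  have hδ := sqMeanRate_initialMean h
  have hrate : ∀ t ∈ Finset.Icc 1 S.T, InvRate fun n =>
      (∫ ω, qform (S.P t + S.F t) (initialMean x₁ n ω - μx) ∂μΩ)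
      - 2 * ∫ ω, (S.approxMean μx μx t - μx
        + (meanField (S.randomState x₁ w (S.proposed μx n) (fun _ => μx) ω t)
          - S.approxMean μx μx t)) ⬝ᵥ ((S.P t + S.F t) *ᵥ (initialMean x₁ n ω - μx)) ∂μΩ :=
    fun t ht => by
      have r1 : InvRate fun n => ∫ ω, qform (S.P t + S.F t) (initialMean x₁ n ω - μx) ∂μΩ :=
        hδ.integral_bilin hδ (S.P t + S.F t)
      exact r1.sub (((S.sqMeanRate_approxMean h (fun _ _ => μx)
        (Finset.mem_Icc.1 ht).1).integral_bilin_add_const hδ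
        (fun n hn => integral_initialMean_sub h hn) (S.P t + S.F t)
        (S.approxMean μx μx t - μx)).const_mul 2)
  refine (InvRate.sum _ hrate).congr fun n hn => ?_
  obtain ⟨hx, hu⟩ := S.memLp_proposed h (memLp_const (μ := μΩ) μx) n
  have i0 := S.integrable_cost hS hn (memLp_const (μ := μΩ) μx) hx hu
  have i1 : ∀ t ∈ Finset.Icc 1 S.T,
      Integrable (fun ω => qform (S.P t + S.F t) (initialMean x₁ n ω - μx)) μΩ := fun t _ =>
    integrable_qform (hδ.1 n hn) _
  have i2 : ∀ t ∈ Finset.Icc 1 S.T, Integrable (fun ω =>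
      2 * ((meanField (S.randomState x₁ w (S.proposed μx n) (fun _ => μx) ω t) - μx) ⬝ᵥ
        ((S.P t + S.F t) *ᵥ (initialMean x₁ n ω - μx)))) μΩ := fun t ht =>
    (integrable_bilin ((memLp_meanField
      (hx t (Finset.Icc_subset_Icc le_rfl (Nat.le_succ S.T) ht))).sub (memLp_const μx))
      (hδ.1 n hn) (S.P t + S.F t)).const_mul 2
  have i3 : ∀ t ∈ Finset.Icc 1 S.T, Integrable (fun ω =>
      qform (S.P t + S.F t) (initialMean x₁ n ω - μx)
      - 2 * ((meanField (S.randomState x₁ w (S.proposed μx n) (fun _ => μx) ω t) - μx) ⬝ᵥ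
        ((S.P t + S.F t) *ᵥ (initialMean x₁ n ω - μx)))) μΩ := fun t ht =>
    (i1 t ht).sub (i2 t ht)
  rw [integral_congr_ae (ae_of_all _ fun ω =>
      S.cost_sub_cost hS hn (initialMean x₁ n ω) μx
        (S.randomState x₁ w (S.proposed μx n) (fun _ => μx) ω)
        (S.randomAction x₁ w (S.proposed μx n) (fun _ => μx) ω)),
    integral_add i0 (integrable_finsetSum _ i3), add_sub_cancel_left, integral_finsetSum _ i3]
  refine Finset.sum_congr rfl fun t ht => ?_
  rw [integral_sub (i1 t ht) (i2 t ht), integral_const_mul]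
  simp only [sub_add_sub_cancel']

end MeanSquare

end Network

/-! ### Almost sure convergence -/

namespace Network

variable {dx du : ℕ} (S : Network dx du) {Ω : Type*} {μx : Vec dx} {x₁ : ℕ → Ω → Vec dx}
  {w : ℕ → ℕ → Ω → Vec dx}

/-- Both strategies move with the same deviations from the mean-field, and where the laws of large
numbers hold both mean-fields approach `z`; so the trajectories merge, uniformly in the followers,
also when the two references only merge in the limit. -/
theorem tendsto_proposed_sub_meanFieldPolicy {r r' : ℕ → Ω → Vec dx} {ω : Ω}
    (hx : Tendsto (fun n : ℕ => initialMean x₁ n ω) atTop (𝓝 μx))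
    (hw : ∀ t, Tendsto (fun n : ℕ => meanField (fun j : Fin n => w t j ω)) atTop (𝓝 0))
    (hr : Tendsto (fun n => r' n ω - r n ω) atTop (𝓝 0)) {t : ℕ} (ht : 1 ≤ t) :
    Tendsto (fun n : ℕ => ‖S.randomState x₁ w (S.proposed μx n) (r n) ω t
      - S.randomState x₁ w (S.meanFieldPolicy n) (r' n) ω t‖) atTop (𝓝 0) := by
  have hmul : ∀ (N : Matrix (Fin dx) (Fin dx) ℝ) {f : ℕ → Vec dx}, Tendsto f atTop (𝓝 0) →
      Tendsto (fun n => N *ᵥ f n) atTop (𝓝 0) := fun N f hf => by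
    have := ((LinearMap.toContinuousLinearMap (mulVecLin N)).continuous.tendsto 0).comp hf
    rwa [map_zero] at this
  have hx0 : Tendsto (fun n : ℕ => initialMean x₁ n ω - μx) atTop (𝓝 0) := by
    simpa using hx.sub_const μx
  have h1 : Tendsto (fun n => meanField (S.randomState x₁ w (S.proposed μx n) (r n) ω t)
      - S.approxMean μx (r n ω) t) atTop (𝓝 0) := by
    induction t, ht using Nat.le_induction with
    | base => exact hx0
    | succ t ht ih =>
      have := (hmul (S.A t + S.B t * S.Lbreve t + S.D t) ih).add (hw t)
      rw [add_zero] at this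
      refine this.congr' ((eventually_ge_atTop 1).mono fun n hn => ?_)
      exact (S.meanField_proposed_sub_approxMean_succ _ _ _ hn μx ht).symm
  have h2 : Tendsto (fun n => meanField (S.randomState x₁ w (S.meanFieldPolicy n) (r' n) ω t)
      - S.approxMean μx (r n ω) t) atTop (𝓝 0) := by
    clear h1
    induction t, ht using Nat.le_induction with
    | base => exact hx0
    | succ t ht ih =>
      have := ((hmul (S.A t + S.B t * S.Lmean t + S.D t) ih).add
        (hmul (S.B t * S.Lref t + S.E t) hr)).add (hw t)
      rw [add_zero, add_zero] at this
      refine this.congr' ((eventually_ge_atTop 1).mono fun n hn => ?_)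
      exact (S.meanField_optimal_sub_approxMean_succ _ _ _ hn μx _ ht).symm
  have h3 := (h1.sub h2).norm
  simp only [sub_sub_sub_cancel_right, sub_zero, norm_zero] at h3
  exact squeeze_zero' (Eventually.of_forall fun _ => norm_nonneg _)
    ((eventually_ge_atTop 1).mono fun n hn =>
      S.norm_state_feedback_sub_le (fun t _ r => S.approxMean μx r t) _ _ _ hn
        (fun _ x _ => meanField x) _ ht) h3

end Network

theorem ENNReal.ofReal_le_ofReal_add_of_abs_sub_le {a b c : ℝ} (h : |a - b| ≤ c) :
    ENNReal.ofReal a ≤ ENNReal.ofReal b + ENNReal.ofReal c :=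
  (ENNReal.ofReal_le_ofReal (by linarith [(abs_le.1 h).2])).trans ENNReal.ofReal_add_le

/-! ### Optimality and steering -/

theorem mainTheorem3 {dx du : ℕ} (S : Network dx du) (hS : S.Admissible)
    {Ω : Type*} [MeasurableSpace Ω] (μΩ : Measure Ω) [IsProbabilityMeasure μΩ]
    (μx : Vec dx) (x₁ : ℕ → Ω → Vec dx) (w : ℕ → ℕ → Ω → Vec dx)
    (hprim : PrimitiveVariables μΩ μx x₁ w) :
    -- reference `x⁰ ≡ x̄₁`: the proposed strategy is `O(1/n)`-optimal for tracking `x̄₁`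
    (∃ C : ℝ, ∀ n : ℕ, 1 ≤ n →
      S.optimalCost x₁ w μΩ n (initialMean x₁ n) ≠ ⊤ ∧
      S.expectedCost x₁ w μΩ (initialMean x₁ n) (initialMean x₁ n) (S.meanFieldPolicy n)
        = S.optimalCost x₁ w μΩ n (initialMean x₁ n) ∧
      S.optimalCost x₁ w μΩ n (initialMean x₁ n)
        ≤ S.expectedCost x₁ w μΩ (initialMean x₁ n) (initialMean x₁ n) (S.proposed μx n) ∧
      S.expectedCost x₁ w μΩ (initialMean x₁ n) (initialMean x₁ n) (S.proposed μx n)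
        ≤ S.optimalCost x₁ w μΩ n (initialMean x₁ n) + ENNReal.ofReal (C / n)) ∧
    -- and it steers all followers along the trajectories that are optimal for tracking `x̄₁`
    -- (the norm is the maximum over the followers)
    (∀ᵐ ω ∂μΩ, ∀ t ∈ Finset.Icc 1 (S.T + 1), Tendsto
      (fun n : ℕ => ‖S.randomState x₁ w (S.proposed μx n) (initialMean x₁ n) ω t
        - S.randomState x₁ w (S.meanFieldPolicy n) (initialMean x₁ n) ω t‖) atTop (𝓝 0)) ∧
    -- the initial mean converges to its expectation
    (∀ᵐ ω ∂μΩ, Tendsto (fun n : ℕ => initialMean x₁ n ω) atTop (𝓝 μx)) ∧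
    -- reference `x⁰ ≡ μx`: the proposed strategy is `O(1/n)`-optimal for tracking `μx`,
    -- and its cost for tracking `x̄₁` is within `O(1/n)` of the optimal cost for tracking `x̄₁`
    (∃ C : ℝ, ∀ n : ℕ, 1 ≤ n →
      S.optimalCost x₁ w μΩ n (fun _ => μx) ≠ ⊤ ∧
      S.optimalCost x₁ w μΩ n (fun _ => μx)
        ≤ S.expectedCost x₁ w μΩ (fun _ => μx) (fun _ => μx) (S.proposed μx n) ∧
      S.expectedCost x₁ w μΩ (fun _ => μx) (fun _ => μx) (S.proposed μx n)
        ≤ S.optimalCost x₁ w μΩ n (fun _ => μx) + ENNReal.ofReal (C / n) ∧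
      S.optimalCost x₁ w μΩ n (initialMean x₁ n)
        ≤ S.expectedCost x₁ w μΩ (initialMean x₁ n) (fun _ => μx) (S.proposed μx n)
          + ENNReal.ofReal (C / n) ∧
      S.expectedCost x₁ w μΩ (initialMean x₁ n) (fun _ => μx) (S.proposed μx n)
        ≤ S.optimalCost x₁ w μΩ n (initialMean x₁ n) + ENNReal.ofReal (C / n)) ∧
    -- and it still steers all followers along the trajectories that are optimal for tracking `x̄₁`
    (∀ᵐ ω ∂μΩ, ∀ t ∈ Finset.Icc 1 (S.T + 1), Tendsto
      (fun n : ℕ => ‖S.randomState x₁ w (S.proposed μx n) (fun _ => μx) ω t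
        - S.randomState x₁ w (S.meanFieldPolicy n) (initialMean x₁ n) ω t‖) atTop (𝓝 0)) := by

  have hmean : ∀ᵐ ω ∂μΩ, Tendsto (fun n : ℕ => initialMean x₁ n ω) atTop (𝓝 μx) :=
    ae_tendsto_meanField hprim.pairwise_indep_init hprim.identDistrib_init
      (hprim.memLp_init.integrable (by norm_num)) hprim.mean_init
  have hnoise : ∀ᵐ ω ∂μΩ, ∀ t,
      Tendsto (fun n : ℕ => meanField (fun j : Fin n => w t j ω)) atTop (𝓝 0) :=
    ae_all_iff.2 fun t => ae_tendsto_meanField (hprim.pairwise_indep_noise t)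
      (hprim.identDistrib_noise t) ((hprim.memLp_noise t).integrable (by norm_num))
      (hprim.mean_noise t)
  have hm : ∀ n, Measurable[initialSigma x₁] (initialMean x₁ n) :=
    measurable_initialMean_initialSigma
  have hm2 := hprim.memLp_initialMean
  have hc : Measurable[initialSigma x₁] fun _ : Ω => μx :=
    @measurable_const _ _ _ (initialSigma x₁) μx
  have hc2 : MemLp (fun _ : Ω => μx) 2 μΩ := memLp_const μx
  refine ⟨?_, ?_, hmean, ?_, ?_⟩
  · obtain ⟨C, hC⟩ := S.invRate_gap_proposed hprim (initialMean x₁)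
    refine ⟨C, fun n hn => ?_⟩
    rw [S.optimalCost_eq hS hn hprim (hm n) (hm2 n),
      S.expectedCost_meanFieldPolicy hS hn hprim (hm n) (hm2 n),
      S.expectedCost_proposed hS hn hprim (hm n) (hm2 n)]
    refine ⟨ENNReal.ofReal_ne_top, rfl, ENNReal.ofReal_le_ofReal
      (le_add_of_nonneg_right (S.gap_nonneg hS _ _)), ?_⟩
    exact ENNReal.ofReal_le_ofReal_add_of_abs_sub_le (by simpa using hC n hn)
  · filter_upwards [hmean, hnoise] with ω h1 h2 t ht
    exact S.tendsto_proposed_sub_meanFieldPolicy (r := initialMean x₁) (r' := initialMean x₁)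
      h1 h2 (by simp) (Finset.mem_Icc.1 ht).1
  · have hgap := S.invRate_gap_proposed hprim fun _ _ => μx
    obtain ⟨D, hD⟩ :=
      ((S.invRate_cost_target_sub hS hprim).add hgap).sub (S.invRate_value_sub hS hprim)
    obtain ⟨C, hC⟩ := hgap
    refine ⟨max C D, fun n hn => ?_⟩
    have hCn : C / n ≤ max C D / n := by gcongr; exact le_max_left C D
    have hDn : D / n ≤ max C D / n := by gcongr; exact le_max_right C D
    obtain ⟨hx, hu⟩ := S.memLp_proposed hprim hc2 n
    have hint := S.integral_cost hS hn hprim (S.measurable_proposed μx) hc hc2 hx hu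
    have hD' := (hD n hn).trans hDn
    simp only [hint] at hD'
    rw [S.optimalCost_eq hS hn hprim (hm n) (hm2 n), S.optimalCost_eq hS hn hprim hc hc2,
      S.expectedCost_proposed hS hn hprim hc hc2,
      S.expectedCost_eq_ofReal_integral hS hn (hm2 n) hx hu]
    refine ⟨ENNReal.ofReal_ne_top, ENNReal.ofReal_le_ofReal
      (le_add_of_nonneg_right (S.gap_nonneg hS _ _)), ?_, ?_, ?_⟩
    · exact ENNReal.ofReal_le_ofReal_add_of_abs_sub_le (by simpa using (hC n hn).trans hCn)
    · refine ENNReal.ofReal_le_ofReal_add_of_abs_sub_le ?_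
      exact abs_le.2 ⟨by linarith [(abs_le.1 hD').2], by linarith [(abs_le.1 hD').1]⟩
    · refine ENNReal.ofReal_le_ofReal_add_of_abs_sub_le ?_
      exact abs_le.2 ⟨by linarith [(abs_le.1 hD').1], by linarith [(abs_le.1 hD').2]⟩
  · filter_upwards [hmean, hnoise] with ω h1 h2 t ht
    exact S.tendsto_proposed_sub_meanFieldPolicy (r := fun _ _ => μx) (r' := initialMean x₁)
      h1 h2 (by simpa using h1.sub_const μx) (Finset.mem_Icc.1 ht).1
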